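/- Let $(X_{ni})_{n\ge1,\,1\le i\le N_n}$, with $N_n\ge1$, be a triangular array of integrable real random variables with $\mathbb E X_{ni}=0$, where for each $n$ the variables $(X_{ni})_{i}$ of the $n$-th row are defined on a common probability space. Let $(m_n)_n$ be a sequence of integers with $m_n\ge1$, and suppose that the array is $(m_n)$-dependent: for every $n$ and every $k$, the two families $\{X_{ni}\}_{i\le k}$ and $\{X_{ni}\}_{i>k+m_n}$ are independent of each other. Let $S_n:=\sum_{i=1}^{N_n}X_{ni}$ and $\sigma_n^2:=\operatorname{Var}S_n$. (a) Suppose that $\sigma_n^2>0$ for all large $n$ and that for some fixed real $r>2$, as $n\to\infty$, $$\frac{m_n^{r-1}}{\sigma_n^r}\sum_{i=1}^{N_n}\mathbb E|X_{ni}|^r\to0 \qquad (\ast)$$ (in particular, the expectations are finite for all large $n$). Then $S_n/\sigma_n\to N(0,1)$ in distribution as $n\to\infty$. (b) (Berk's theorem is a special case.) Suppose that for some $\delta>0$ and some constants $C$ and $c>0$ we have $\mathbb E|X_{ni}|^{2+\delta}\le C$ for all $n$ and $i$, $\sigma_n^2/N_n\to c$, and $m_n^{2+2/\delta}=o(N_n)$.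 Then $\sigma_n^2>0$ for all large $n$ and $(\ast)$ holds with $r=2+\delta$; consequently $S_n/\sigma_n\to N(0,1)$ in distribution. (c) (The Romano–Wolf theorem is a special case.) Suppose that for some $\delta>0$, some $\gamma\in[-1,1)$, and some real sequences $\Delta_n$ and $L_n$ with $L_n>0$ for all large $n$, we have $\mathbb E|X_{ni}|^{2+\delta}\le\Delta_n$ for all $n$ and $i$, $\sigma_n^2/(N_nm_n^\gamma)\ge L_n$ for all $n$, $\Delta_n/L_n^{(2+\delta)/2}=O(1)$, and $m_n^{1+(1-\gamma)(1+2/\delta)}/N_n\to0$. Then $\sigma_n^2>0$ for all large $n$ and $(\ast)$ holds with $r=2+\delta$; consequently $S_n/\sigma_n\to N(0,1)$ in distribution. -/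

import Mathlib

open MeasureTheory ProbabilityTheory Filter Asymptotics
open scoped Topology

/-- A finite sequence `X_1, …, X_N` of random variables (`X_{i+1}` is `X i` with `i : Fin N`) is
`m`-dependent if, for every `k`, the families `(X_i)_{i ≤ k}` and `(X_i)_{i > k + m}`
are independent of each other. -/
def MDependent {Ω : Type*} [MeasurableSpace Ω] {N : ℕ} (m : ℕ) (X : Fin N → Ω → ℝ)
    (P : Measure Ω) : Prop :=
  ∀ k : ℕ, IndepFun
    (fun ω (i : {i : Fin N // i.val < k}) => X i.1 ω)
    (fun ω (j : {j : Fin N // k + m ≤ j.val}) => X j.1 ω) P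

/-- The row sum of the `n`-th row of a triangular array. -/
def rowSum {Ω : ℕ → Type*} {N : ℕ → ℕ} (X : ∀ n, Fin (N n) → Ω n → ℝ) (n : ℕ) (ω : Ω n) : ℝ :=
  ∑ i, X n i ω

/-- The variance of the `n`-th row sum. -/
noncomputable def rowVar {Ω : ℕ → Type*} [∀ n, MeasurableSpace (Ω n)] {N : ℕ → ℕ}
    (P : ∀ n, Measure (Ω n)) (X : ∀ n, Fin (N n) → Ω n → ℝ) (n : ℕ) : ℝ :=
  Var[rowSum X n; P n]

/-- The standard deviation of the `n`-th row sum. -/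
noncomputable def rowStd {Ω : ℕ → Type*} [∀ n, MeasurableSpace (Ω n)] {N : ℕ → ℕ}
    (P : ∀ n, Measure (Ω n)) (X : ∀ n, Fin (N n) → Ω n → ℝ) (n : ℕ) : ℝ :=
  √(rowVar P X n)

/-- The Lyapunov condition with exponent `r`: `(m_n ^ (r - 1) / σ_n ^ r) ∑ᵢ E|X_{ni}|^r → 0`.
The expectations have to be finite for all large `n`. -/
def LyapunovCondition {Ω : ℕ → Type*} [∀ n, MeasurableSpace (Ω n)] {N : ℕ → ℕ}
    (P : ∀ n, Measure (Ω n)) (X : ∀ n, Fin (N n) → Ω n → ℝ) (m : ℕ → ℕ) (r : ℝ) : Prop :=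
  (∀ᶠ n in atTop, ∀ i, Integrable (fun ω => |X n i ω| ^ r) (P n)) ∧
  Tendsto (fun n => (m n : ℝ) ^ (r - 1) / rowStd P X n ^ r * ∑ i, ∫ ω, |X n i ω| ^ r ∂(P n))
    atTop (𝓝 0)

/-- `S_n / σ_n` converges in distribution to the standard normal law. -/
def AsymptoticallyNormal {Ω : ℕ → Type*} [∀ n, MeasurableSpace (Ω n)] {N : ℕ → ℕ}
    (P : ∀ n, Measure (Ω n)) [∀ n, IsProbabilityMeasure (P n)]
    (X : ∀ n, Fin (N n) → Ω n → ℝ) : Prop :=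
  TendstoInDistribution (fun n ω => rowSum X n ω / rowStd P X n) atTop
    (id : ℝ → ℝ) P (gaussianReal 0 1)

/-- The moment, variance and growth assumptions of Berk's theorem, for some constants. -/
def BerkCondition {Ω : ℕ → Type*} [∀ n, MeasurableSpace (Ω n)] {N : ℕ → ℕ}
    (P : ∀ n, Measure (Ω n)) (X : ∀ n, Fin (N n) → Ω n → ℝ) (m : ℕ → ℕ) (δ : ℝ) : Prop :=
  (∃ C : ℝ, ∀ n i, Integrable (fun ω => |X n i ω| ^ (2 + δ)) (P n) ∧
    ∫ ω, |X n i ω| ^ (2 + δ) ∂(P n) ≤ C) ∧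
  (∃ c : ℝ, 0 < c ∧ Tendsto (fun n => rowVar P X n / (N n : ℝ)) atTop (𝓝 c)) ∧
  (fun n => (m n : ℝ) ^ (2 + 2 / δ)) =o[atTop] (fun n => (N n : ℝ))

/-- The moment, variance and growth assumptions of the theorem of Romano and Wolf,
for some sequences `Δ_n` and `L_n`. -/
def RomanoWolfCondition {Ω : ℕ → Type*} [∀ n, MeasurableSpace (Ω n)] {N : ℕ → ℕ}
    (P : ∀ n, Measure (Ω n)) (X : ∀ n, Fin (N n) → Ω n → ℝ) (m : ℕ → ℕ) (δ γ : ℝ) : Prop :=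
  ∃ Δ L : ℕ → ℝ, (∀ᶠ n in atTop, 0 < L n) ∧
    (∀ n i, Integrable (fun ω => |X n i ω| ^ (2 + δ)) (P n) ∧
      ∫ ω, |X n i ω| ^ (2 + δ) ∂(P n) ≤ Δ n) ∧
    (∀ n, L n ≤ rowVar P X n / ((N n : ℝ) * (m n : ℝ) ^ γ)) ∧
    (fun n => Δ n / L n ^ ((2 + δ) / 2)) =O[atTop] (fun _ => (1 : ℝ)) ∧
    Tendsto (fun n => (m n : ℝ) ^ (1 + (1 - γ) * (1 + 2 / δ)) / (N n : ℝ)) atTop (𝓝 0)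

/-! Sums of `m` consecutive variables, divided by the standard deviation, form a one-dependent
sequence W whose sum has variance 1, and convexity of |x|^r bounds ∑ E|W_j|^r by the Lyapunov ratio.
What is needed is thus a central limit theorem for one-dependent sequences with small ratio. The
difficulty is cancellation: ∑ E W_j² may be much larger than the variance of the sum, so the errors
have to be measured against the latter.

Truncate W at a small level ε. The removed parts are one-dependent again, so their sum has variance
at most 3 ε^(2-r) ∑ E|W_j|^r, which is negligible. Let Y be the truncated centered variables and F_k
the σ-algebra of the first k of them. One-dependence gives E[Y_{k+1} | F_k] = 0, so D_k = Y_k +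
E[Y_{k+1} | F_{k+1}] - E[Y_k | F_k] are martingale differences, and by telescoping their partial
sums differ from those of Y only by O(ε) (`sum_eq_sum_martDiff`, `BddOneDep.bddMartDiff`). The
quantity ∑ E D_k² is additive over blocks and, over the whole sequence, equals Var ∑ Y_k
(`BddOneDep.sum_integral_martDiff_sq`): it keeps track of the cancellation. Since D_i is independent
of Y_{i+2}, Y_{i+3}, …, the quadratic variation has a controlled second moment, and a block with
D-variance v has a martingale sum with fourth moment O((ε² + v) v).

Now peel off, from the right, blocks of D-variance between η and 10η. Omitting a single Y makes a
block independent of everything before it, so the characteristic function factorizes up to O(|t| ε),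
and a Taylor expansion replaces the block factor by a Gaussian one with error of order η^(3/2) for
fixed t. With about 1/η blocks the total error is of order ε/η + √η
(`BddOneDep.norm_chf_sum_sub_exp_le`); it becomes small on choosing η, then ε, then n.

Part (b) is the case γ = 0 of (c), and (c) follows from an explicit bound on the Lyapunov ratio. -/

/-! ### Bounded measurable functions -/

/-- A bounded real function, measurable with respect to the σ-algebra `m`. -/
def BddMeas {Ω : Type*} (m : MeasurableSpace Ω) (f : Ω → ℝ) : Prop :=
  Measurable[m] f ∧ ∃ C : ℝ, ∀ ω, |f ω| ≤ C

namespace BddMeas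

variable {Ω : Type*} {m m' : MeasurableSpace Ω} {f g : Ω → ℝ}

lemma mono (hf : BddMeas m f) (h : m ≤ m') : BddMeas m' f := ⟨hf.1.mono h le_rfl, hf.2⟩

lemma const (c : ℝ) : BddMeas m (fun _ => c) := ⟨measurable_const, |c|, fun _ => le_rfl⟩

lemma add (hf : BddMeas m f) (hg : BddMeas m g) : BddMeas m (fun ω => f ω + g ω) := by
  obtain ⟨hf, C, hC⟩ := hf
  obtain ⟨hg, C', hC'⟩ := hg
  exact ⟨hf.add hg, C + C', fun ω => (abs_add_le _ _).trans (add_le_add (hC ω) (hC' ω))⟩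

lemma mul (hf : BddMeas m f) (hg : BddMeas m g) : BddMeas m (fun ω => f ω * g ω) := by
  obtain ⟨hf, C, hC⟩ := hf
  obtain ⟨hg, C', hC'⟩ := hg
  refine ⟨hf.mul hg, C * C', fun ω => ?_⟩
  rw [abs_mul]
  exact mul_le_mul (hC ω) (hC' ω) (abs_nonneg _) ((abs_nonneg _).trans (hC ω))

lemma const_mul (c : ℝ) (hf : BddMeas m f) : BddMeas m (fun ω => c * f ω) := (const c).mul hf

lemma sub (hf : BddMeas m f) (hg : BddMeas m g) : BddMeas m (fun ω => f ω - g ω) := by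
  simpa [sub_eq_add_neg] using hf.add (hg.const_mul (-1))

lemma pow (hf : BddMeas m f) (n : ℕ) : BddMeas m (fun ω => f ω ^ n) := by
  induction n with
  | zero => simpa using const 1
  | succ n ih => simpa [pow_succ] using ih.mul hf

lemma sum {ι : Type*} {s : Finset ι} {F : ι → Ω → ℝ} (h : ∀ i ∈ s, BddMeas m (F i)) :
    BddMeas m (fun ω => ∑ i ∈ s, F i ω) := by
  classical
  induction s using Finset.induction_on with
  | empty => simpa using const 0
  | insert a s ha ih =>
    simp only [Finset.sum_insert ha]
    exact (h a (by simp)).add (ih fun i hi => h i (by simp [hi]))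

lemma integrable {P : Measure[m] Ω} [IsFiniteMeasure P] (hf : BddMeas m f) : Integrable f P := by
  obtain ⟨hf, C, hC⟩ := hf
  exact Integrable.of_bound hf.aestronglyMeasurable C (ae_of_all _ fun ω => by simpa using hC ω)

lemma integral_add {P : Measure[m] Ω} [IsFiniteMeasure P] (hf : BddMeas m f) (hg : BddMeas m g) :
    ∫ ω, (f ω + g ω) ∂P = ∫ ω, f ω ∂P + ∫ ω, g ω ∂P :=
  MeasureTheory.integral_add hf.integrable hg.integrable

end BddMeas

/-! ### Bounded martingale differences and fourth moments -/

/-- Uniformly bounded martingale differences. -/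
structure BddMartDiff {Ω : Type*} [mΩ : MeasurableSpace Ω] (P : Measure Ω)
    (ℱ : Filtration ℕ mΩ) (c : ℝ) (D : ℕ → Ω → ℝ) : Prop where
  bddMeas : ∀ k, BddMeas (ℱ (k + 1)) (D k)
  abs_le : ∀ k ω, |D k ω| ≤ c
  orth : ∀ k G, BddMeas (ℱ k) G → ∫ ω, G ω * D k ω ∂P = 0

namespace BddMartDiff

variable {Ω : Type*} [mΩ : MeasurableSpace Ω] {P : Measure Ω}
  {ℱ : Filtration ℕ mΩ} {c : ℝ} {D : ℕ → Ω → ℝ}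

lemma bddMeas_of_lt (h : BddMartDiff P ℱ c D) {i k : ℕ} (hik : i < k) : BddMeas (ℱ k) (D i) :=
  (h.bddMeas i).mono (ℱ.mono hik)

lemma bddMeas_top (h : BddMartDiff P ℱ c D) (k : ℕ) : BddMeas mΩ (D k) :=
  (h.bddMeas k).mono (ℱ.le _)

lemma bddMeas_sum (h : BddMartDiff P ℱ c D) (a : ℕ) {b k : ℕ} (hb : b ≤ k) :
    BddMeas (ℱ k) (fun ω => ∑ i ∈ Finset.Ico a b, D i ω) :=
  BddMeas.sum fun _ hi => h.bddMeas_of_lt ((Finset.mem_Ico.1 hi).2.trans_le hb)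

lemma bddMeas_sum_top (h : BddMartDiff P ℱ c D) (a b : ℕ) :
    BddMeas mΩ (fun ω => ∑ i ∈ Finset.Ico a b, D i ω) :=
  (h.bddMeas_sum a le_rfl).mono (ℱ.le b)

lemma bddMeas_sum_sq_top (h : BddMartDiff P ℱ c D) (a b : ℕ) :
    BddMeas mΩ (fun ω => ∑ i ∈ Finset.Ico a b, D i ω ^ 2) :=
  BddMeas.sum fun _ _ => (h.bddMeas_top _).pow 2

variable [IsProbabilityMeasure P]

lemma integral_mul_sum_eq_zero (h : BddMartDiff P ℱ c D) {a : ℕ} (b : ℕ) {G : Ω → ℝ}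
    (hG : BddMeas (ℱ a) G) : ∫ ω, G ω * ∑ i ∈ Finset.Ico a b, D i ω ∂P = 0 := by
  simp_rw [Finset.mul_sum]
  rw [integral_finsetSum]
  · exact Finset.sum_eq_zero fun i hi =>
      h.orth i G (hG.mono (ℱ.mono (Finset.mem_Ico.1 hi).1))
  · exact fun i _ => ((hG.mono (ℱ.le a)).mul (h.bddMeas_top i)).integrable

lemma integral_mul_sum_sq (h : BddMartDiff P ℱ c D) {a b : ℕ} (hab : a ≤ b) {G : Ω → ℝ}
    (hG : BddMeas (ℱ a) G) : ∫ ω, G ω * (∑ i ∈ Finset.Ico a b, D i ω) ^ 2 ∂P =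
      ∑ i ∈ Finset.Ico a b, ∫ ω, G ω * D i ω ^ 2 ∂P := by
  induction b, hab using Nat.le_induction with
  | base => simp
  | succ b hab ih =>
    have hGb : BddMeas (ℱ b) G := hG.mono (ℱ.mono hab)
    have hM := h.bddMeas_sum a (le_refl b)
    rw [Finset.sum_Ico_succ_top hab, ← ih]
    have e : ∀ ω, G ω * (∑ i ∈ Finset.Ico a (b + 1), D i ω) ^ 2 =
        G ω * (∑ i ∈ Finset.Ico a b, D i ω) ^ 2 +
          (2 * (G ω * ∑ i ∈ Finset.Ico a b, D i ω)) * D b ω + G ω * D b ω ^ 2 := fun ω => by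
      rw [Finset.sum_Ico_succ_top hab]; ring
    have i1 := (hGb.mul (hM.pow 2)).mono (ℱ.le b)
    have i2 := ((hGb.mul hM).const_mul 2)
    have i3 := (i2.mono (ℱ.le b)).mul (h.bddMeas_top b)
    have i4 := (hGb.mono (ℱ.le b)).mul ((h.bddMeas_top b).pow 2)
    simp_rw [e]
    rw [(i1.add i3).integral_add i4, i1.integral_add i3, h.orth b _ i2, add_zero]

lemma integral_sum_sq (h : BddMartDiff P ℱ c D) {a b : ℕ} (hab : a ≤ b) :
    ∫ ω, (∑ i ∈ Finset.Ico a b, D i ω) ^ 2 ∂P = ∑ i ∈ Finset.Ico a b, ∫ ω, D i ω ^ 2 ∂P := by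
  simpa using h.integral_mul_sum_sq hab (BddMeas.const 1)

lemma integral_pow_four_le (h : BddMartDiff P ℱ c D) (i : ℕ) :
    ∫ ω, D i ω ^ 4 ∂P ≤ c ^ 2 * ∫ ω, D i ω ^ 2 ∂P := by
  rw [← integral_const_mul]
  refine integral_mono ((h.bddMeas_top i).pow 4).integrable
    (((h.bddMeas_top i).pow 2).const_mul _).integrable fun ω => ?_
  have h2 : D i ω ^ 2 ≤ c ^ 2 := sq_le_sq' (_root_.abs_le.1 (h.abs_le i ω)).1 (_root_.abs_le.1 (h.abs_le i ω)).2
  simpa [← pow_add] using mul_le_mul_of_nonneg_right h2 (sq_nonneg (D i ω))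

/-- Second moment of the quadratic variation. -/
lemma integral_quadVar_sq_le (h : BddMartDiff P ℱ c D) {a b : ℕ} (hab : a ≤ b) {K : ℝ}
    (hK : ∀ i ∈ Finset.Ico a b, ∫ ω, D i ω ^ 2 * (∑ k ∈ Finset.Ico (i + 1) b, D k ω) ^ 2 ∂P ≤
      K * ∫ ω, D i ω ^ 2 ∂P) :
    ∫ ω, (∑ i ∈ Finset.Ico a b, D i ω ^ 2) ^ 2 ∂P ≤
      (c ^ 2 + 2 * K) * ∑ i ∈ Finset.Ico a b, ∫ ω, D i ω ^ 2 ∂P := by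
  induction hn : b - a generalizing a with
  | zero =>
    obtain rfl : a = b := by omega
    simp
  | succ n ih =>
    have hlt : a < b := by omega
    have ih' := ih (a := a + 1) (by omega)
      (fun i hi => hK i (by simp only [Finset.mem_Ico] at hi ⊢; omega)) (by omega)
    have hKa := hK a (by simp [hlt])
    have h4 := h.integral_pow_four_le a
    -- By orthogonality, the hypothesis on D_a² times the squared tail sum becomes a bound on D_a²
    -- times the tail of the quadratic variation, the cross term in the expansion below.
    rw [h.integral_mul_sum_sq hlt ((h.bddMeas a).pow 2)] at hKa
    have hq := h.bddMeas_sum_sq_top (a + 1) b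
    have hd := (h.bddMeas_top a).pow 2
    have e : ∀ ω, (∑ i ∈ Finset.Ico a b, D i ω ^ 2) ^ 2 = D a ω ^ 4 +
        2 * (D a ω ^ 2 * ∑ i ∈ Finset.Ico (a + 1) b, D i ω ^ 2) +
        (∑ i ∈ Finset.Ico (a + 1) b, D i ω ^ 2) ^ 2 := fun ω => by
      rw [Finset.sum_eq_sum_Ico_succ_bot hlt]; ring
    have i1 := (h.bddMeas_top a).pow 4
    have i2 := (hd.mul hq).const_mul 2
    simp_rw [e]
    rw [(i1.add i2).integral_add (hq.pow 2), i1.integral_add i2, integral_const_mul,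
      Finset.sum_eq_sum_Ico_succ_bot hlt]
    have e2 : ∫ ω, D a ω ^ 2 * ∑ i ∈ Finset.Ico (a + 1) b, D i ω ^ 2 ∂P =
        ∑ i ∈ Finset.Ico (a + 1) b, ∫ ω, D a ω ^ 2 * D i ω ^ 2 ∂P := by
      simp_rw [Finset.mul_sum]
      exact integral_finsetSum _ fun i _ => (hd.mul ((h.bddMeas_top i).pow 2)).integrable
    rw [e2]
    linarith

/-- The squared martingale is a submartingale: the increments after i are orthogonal to the bounded
F_{i+1}-measurable factor, so only a nonnegative square is added. This puts the same final sum in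
every term of `integral_sum_pow_four_le_sum`. -/
lemma integral_sq_mul_sq_le (h : BddMartDiff P ℱ c D) {a b i : ℕ} (hai : a ≤ i) (hib : i < b) :
    ∫ ω, (∑ k ∈ Finset.Ico a (i + 1), D k ω) ^ 2 * D i ω ^ 2 ∂P ≤
      ∫ ω, (∑ k ∈ Finset.Ico a b, D k ω) ^ 2 * D i ω ^ 2 ∂P := by
  have hM := h.bddMeas_sum a (le_refl (i + 1))
  have hD := (h.bddMeas i).pow 2
  have hA := h.bddMeas_sum_top (i + 1) b
  have le := ℱ.le (i + 1)
  have e : ∀ ω, (∑ k ∈ Finset.Ico a b, D k ω) ^ 2 * D i ω ^ 2 =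
      (∑ k ∈ Finset.Ico a (i + 1), D k ω) ^ 2 * D i ω ^ 2 +
      2 * ((∑ k ∈ Finset.Ico a (i + 1), D k ω) * D i ω ^ 2) *
        (∑ k ∈ Finset.Ico (i + 1) b, D k ω) +
      (∑ k ∈ Finset.Ico (i + 1) b, D k ω) ^ 2 * D i ω ^ 2 := fun ω => by
    rw [← Finset.sum_Ico_consecutive _ (show a ≤ i + 1 by omega) (show i + 1 ≤ b by omega)]
    ring
  have i1 := ((hM.pow 2).mul hD).mono le
  have b2 := (hM.mul hD).const_mul 2
  have i2 := (b2.mono le).mul hA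
  have i3 := (hA.pow 2).mul (hD.mono le)
  simp_rw [e]
  rw [(i1.add i2).integral_add i3, i1.integral_add i2, h.integral_mul_sum_eq_zero b b2]
  have : 0 ≤ ∫ ω, (∑ k ∈ Finset.Ico (i + 1) b, D k ω) ^ 2 * D i ω ^ 2 ∂P :=
    integral_nonneg fun ω => by positivity
  linarith

/-- Expand the fourth power one increment at a time; the term 4x³y has mean zero by orthogonality.
Writing the remainder with (x + y)² instead of x² prepares for `integral_sq_mul_sq_le`. -/
lemma integral_sum_pow_four_le_sum (h : BddMartDiff P ℱ c D) {a b : ℕ} (hab : a ≤ b) :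
    ∫ ω, (∑ i ∈ Finset.Ico a b, D i ω) ^ 4 ∂P ≤ ∑ i ∈ Finset.Ico a b,
      (16 * ∫ ω, (∑ k ∈ Finset.Ico a (i + 1), D k ω) ^ 2 * D i ω ^ 2 ∂P +
        19 * ∫ ω, D i ω ^ 4 ∂P) := by
  induction b, hab using Nat.le_induction with
  | base => simp
  | succ b hab ih =>
    rw [Finset.sum_Ico_succ_top hab]
    refine le_trans ?_ (add_le_add_left ih _)
    have hM := h.bddMeas_sum a (le_refl b)
    have hM' := hM.mono (ℱ.le b)
    have hD := h.bddMeas_top b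
    have hM1 := h.bddMeas_sum_top a (b + 1)
    have b3 := (hM.pow 3).const_mul 4
    have i1 := hM'.pow 4
    have i2 := (b3.mono (ℱ.le b)).mul hD
    have i3 := ((hM1.pow 2).mul (hD.pow 2)).const_mul 16
    have i4 := (hD.pow 4).const_mul 19
    calc ∫ ω, (∑ i ∈ Finset.Ico a (b + 1), D i ω) ^ 4 ∂P
        ≤ ∫ ω, ((∑ i ∈ Finset.Ico a b, D i ω) ^ 4 +
            4 * (∑ i ∈ Finset.Ico a b, D i ω) ^ 3 * D b ω +
            (16 * ((∑ i ∈ Finset.Ico a (b + 1), D i ω) ^ 2 * D b ω ^ 2) + 19 * D b ω ^ 4)) ∂P := by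
          refine integral_mono (hM1.pow 4).integrable ((i1.add i2).add (i3.add i4)).integrable fun ω => ?_
          simp only [Finset.sum_Ico_succ_top hab]
          set x := ∑ i ∈ Finset.Ico a b, D i ω
          set y := D b ω
          -- The difference of the two sides is y²(10x² + 28xy + 34y²), a positive definite form
          -- times y².
          nlinarith [sq_nonneg (y * (5 * x + 7 * y)), sq_nonneg (x * y), sq_nonneg (y * y),
            sq_nonneg (y * (x + y)), sq_nonneg (y * (x + 2 * y)), sq_nonneg (y * (2 * x + 3 * y))]
      _ = _ := by
          rw [(i1.add i2).integral_add (i3.add i4), i1.integral_add i2, i3.integral_add i4,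
            h.orth b _ b3, integral_const_mul, integral_const_mul, add_zero]

/-- A fourth moment bound for sums of bounded martingale differences. -/
lemma integral_sum_pow_four_le (h : BddMartDiff P ℱ c D) {a b : ℕ} (hab : a ≤ b) {K : ℝ}
    (hK0 : 0 ≤ K)
    (hK : ∀ i ∈ Finset.Ico a b, ∫ ω, D i ω ^ 2 * (∑ k ∈ Finset.Ico (i + 1) b, D k ω) ^ 2 ∂P ≤
      K * ∫ ω, D i ω ^ 2 ∂P) :
    ∫ ω, (∑ i ∈ Finset.Ico a b, D i ω) ^ 4 ∂P ≤
      512 * (c ^ 2 + K) * ∑ i ∈ Finset.Ico a b, ∫ ω, D i ω ^ 2 ∂P := by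
  have hQ := h.integral_quadVar_sq_le hab hK
  have h1 := h.integral_sum_pow_four_le_sum hab
  set v := ∑ i ∈ Finset.Ico a b, ∫ ω, D i ω ^ 2 ∂P with hv
  have hv0 : 0 ≤ v := Finset.sum_nonneg fun i _ => integral_nonneg fun ω => sq_nonneg _
  have hM := h.bddMeas_sum_top a b
  have hq := h.bddMeas_sum_sq_top a b
  have h2 : ∑ i ∈ Finset.Ico a b,
      (16 * ∫ ω, (∑ k ∈ Finset.Ico a (i + 1), D k ω) ^ 2 * D i ω ^ 2 ∂P +
        19 * ∫ ω, D i ω ^ 4 ∂P) ≤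
      16 * (∫ ω, (∑ k ∈ Finset.Ico a b, D k ω) ^ 2 * ∑ i ∈ Finset.Ico a b, D i ω ^ 2 ∂P) +
        19 * c ^ 2 * v := by
    simp_rw [Finset.mul_sum]
    rw [integral_finsetSum _ fun i _ => ((hM.pow 2).mul ((h.bddMeas_top i).pow 2)).integrable,
      hv, Finset.mul_sum, Finset.mul_sum, ← Finset.sum_add_distrib]
    refine Finset.sum_le_sum fun i hi => ?_
    have := h.integral_sq_mul_sq_le (Finset.mem_Ico.1 hi).1 (Finset.mem_Ico.1 hi).2
    have := h.integral_pow_four_le i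
    linarith
  -- Weighted AM-GM; after multiplication by 16 the weight 1/32 leaves half of the fourth moment,
  -- which is absorbed on the left.
  have h3 : ∫ ω, (∑ k ∈ Finset.Ico a b, D k ω) ^ 2 * ∑ i ∈ Finset.Ico a b, D i ω ^ 2 ∂P ≤
      (1 / 32) * (∫ ω, (∑ i ∈ Finset.Ico a b, D i ω) ^ 4 ∂P) +
        8 * ∫ ω, (∑ i ∈ Finset.Ico a b, D i ω ^ 2) ^ 2 ∂P := by
    rw [← integral_const_mul, ← integral_const_mul, ← integral_add
      ((hM.pow 4).const_mul _).integrable ((hq.pow 2).const_mul _).integrable]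
    refine integral_mono ((hM.pow 2).mul hq).integrable
      (((hM.pow 4).const_mul _).add ((hq.pow 2).const_mul _)).integrable fun ω => ?_
    dsimp only
    nlinarith [sq_nonneg ((∑ i ∈ Finset.Ico a b, D i ω) ^ 2 -
      16 * ∑ i ∈ Finset.Ico a b, D i ω ^ 2)]
  have h5 : 0 ≤ c ^ 2 * v := by positivity
  have h6 : 0 ≤ K * v := by positivity
  nlinarith

end BddMartDiff

/-! ### Past and future σ-algebras, one-dependence -/

/-- The σ-algebra generated by the variables with index less than `k`. -/
@[reducible]
def pastAlg {Ω : Type*} (Y : ℕ → Ω → ℝ) (k : ℕ) : MeasurableSpace Ω :=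
  ⨆ i, ⨆ (_ : i < k), MeasurableSpace.comap (Y i) inferInstance

/-- The σ-algebra generated by the variables with index at least `k`. -/
@[reducible]
def futureAlg {Ω : Type*} (Y : ℕ → Ω → ℝ) (k : ℕ) : MeasurableSpace Ω :=
  ⨆ i, ⨆ (_ : k ≤ i), MeasurableSpace.comap (Y i) inferInstance

section

variable {Ω : Type*} {Y : ℕ → Ω → ℝ}

lemma measurable_pastAlg {i k : ℕ} (h : i < k) : Measurable[pastAlg Y k] (Y i) :=
  (comap_measurable (Y i)).mono (le_iSup₂_of_le i h le_rfl) le_rfl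

lemma measurable_futureAlg {i k : ℕ} (h : k ≤ i) : Measurable[futureAlg Y k] (Y i) :=
  (comap_measurable (Y i)).mono (le_iSup₂_of_le i h le_rfl) le_rfl

lemma pastAlg_le {m : MeasurableSpace Ω} {k : ℕ} (h : ∀ i < k, Measurable[m] (Y i)) :
    pastAlg Y k ≤ m :=
  iSup₂_le fun i hi => (h i hi).comap_le

lemma futureAlg_le {m : MeasurableSpace Ω} {k : ℕ} (h : ∀ i, k ≤ i → Measurable[m] (Y i)) :
    futureAlg Y k ≤ m :=
  iSup₂_le fun i hi => (h i hi).comap_le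

lemma pastAlg_mono : Monotone (pastAlg Y) := fun _ _ h =>
  pastAlg_le fun _ hi => measurable_pastAlg (hi.trans_le h)

lemma pastAlg_zero : pastAlg Y 0 = ⊥ := by simp [pastAlg]

end

/-- The natural filtration, shifted so that the `k`-th σ-algebra is generated by the first `k`
variables. -/
def pastFiltration {Ω : Type*} [mΩ : MeasurableSpace Ω] {Y : ℕ → Ω → ℝ}
    (hY : ∀ i, Measurable (Y i)) : Filtration ℕ mΩ where
  seq := pastAlg Y
  mono' := pastAlg_mono
  le' _ := pastAlg_le fun i _ => hY i

/-- One-dependence of a sequence: for every `k`, the first `k` variables are independent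
of those with index greater than `k`. -/
def OneDep {Ω : Type*} [MeasurableSpace Ω] (Y : ℕ → Ω → ℝ) (P : Measure Ω) : Prop :=
  ∀ k, Indep (pastAlg Y k) (futureAlg Y (k + 1)) P

lemma ProbabilityTheory.Indep.indepFun {Ω : Type*} {m₁ m₂ : MeasurableSpace Ω}
    [mΩ : MeasurableSpace Ω] {P : Measure Ω} (h : Indep m₁ m₂ P) {f g : Ω → ℝ} (hf : Measurable[m₁] f)
    (hg : Measurable[m₂] g) : IndepFun f g P :=
  (IndepFun_iff_Indep f g P).2 (indep_of_indep_of_le h hf.comap_le hg.comap_le)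

lemma integral_mul_of_indep {Ω : Type*} {m₁ m₂ : MeasurableSpace Ω}
    [mΩ : MeasurableSpace Ω] {P : Measure Ω} (h₁ : m₁ ≤ mΩ) (h₂ : m₂ ≤ mΩ) (h : Indep m₁ m₂ P)
    {f g : Ω → ℝ} (hf : Measurable[m₁] f) (hg : Measurable[m₂] g) :
    ∫ ω, f ω * g ω ∂P = (∫ ω, f ω ∂P) * ∫ ω, g ω ∂P :=
  (h.indepFun hf hg).integral_fun_mul_eq_mul_integral
    (hf.mono h₁ le_rfl).aestronglyMeasurable (hg.mono h₂ le_rfl).aestronglyMeasurable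

/-! ### Martingale approximation of bounded one-dependent sequences -/

/-- A centered one-dependent sequence that is bounded by `ε`. -/
structure BddOneDep {Ω : Type*} [mΩ : MeasurableSpace Ω] (P : Measure Ω) (ε : ℝ)
    (Y : ℕ → Ω → ℝ) : Prop where
  measurable : ∀ i, Measurable (Y i)
  abs_le : ∀ i ω, |Y i ω| ≤ ε
  integral_eq_zero : ∀ i, ∫ ω, Y i ω ∂P = 0
  oneDep : OneDep Y P

/-- The conditional expectation of `Y k` given the earlier variables, clipped to `[-ε, ε]`. -/
noncomputable def condNext {Ω : Type*} [mΩ : MeasurableSpace Ω] (P : Measure Ω) (ε : ℝ)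
    (Y : ℕ → Ω → ℝ) (k : ℕ) (ω : Ω) : ℝ :=
  max (-ε) (min ε (P[Y k | pastAlg Y k] ω))

/-- The martingale differences approximating a one-dependent sequence. -/
noncomputable def martDiff {Ω : Type*} [mΩ : MeasurableSpace Ω] (P : Measure Ω) (ε : ℝ)
    (Y : ℕ → Ω → ℝ) (k : ℕ) (ω : Ω) : ℝ :=
  Y k ω + condNext P ε Y (k + 1) ω - condNext P ε Y k ω

lemma sum_eq_sum_martDiff {Ω : Type*} [mΩ : MeasurableSpace Ω] (P : Measure Ω) (ε : ℝ)
    (Y : ℕ → Ω → ℝ) {a b : ℕ} (hab : a ≤ b) (ω : Ω) :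
    ∑ i ∈ Finset.Ico a b, Y i ω = ∑ i ∈ Finset.Ico a b, martDiff P ε Y i ω -
      condNext P ε Y b ω + condNext P ε Y a ω := by
  induction b, hab using Nat.le_induction with
  | base => simp
  | succ b hab ih =>
    rw [Finset.sum_Ico_succ_top hab, Finset.sum_Ico_succ_top hab, ih, martDiff]
    ring

namespace BddOneDep

variable {Ω : Type*} [mΩ : MeasurableSpace Ω] {P : Measure Ω} {ε : ℝ} {Y : ℕ → Ω → ℝ}

lemma past_le (h : BddOneDep P ε Y) (k : ℕ) : pastAlg Y k ≤ mΩ :=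
  pastAlg_le fun i _ => h.measurable i

lemma future_le (h : BddOneDep P ε Y) (k : ℕ) : futureAlg Y k ≤ mΩ :=
  futureAlg_le fun i _ => h.measurable i

lemma bound_nonneg [IsProbabilityMeasure P] (h : BddOneDep P ε Y) : 0 ≤ ε := by
  obtain ⟨ω⟩ := nonempty_of_isProbabilityMeasure P
  exact (abs_nonneg _).trans (h.abs_le 0 ω)

lemma bddMeas (h : BddOneDep P ε Y) (i : ℕ) : BddMeas mΩ (Y i) :=
  ⟨h.measurable i, ε, h.abs_le i⟩

lemma bddMeas_future_sum (h : BddOneDep P ε Y) (a b : ℕ) :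
    BddMeas (futureAlg Y a) (fun ω => ∑ i ∈ Finset.Ico a b, Y i ω) :=
  BddMeas.sum fun i hi => ⟨measurable_futureAlg (Finset.mem_Ico.1 hi).1, ε, h.abs_le i⟩

lemma bddMeas_past_sum (h : BddOneDep P ε Y) (a b : ℕ) :
    BddMeas (pastAlg Y b) (fun ω => ∑ i ∈ Finset.Ico a b, Y i ω) :=
  BddMeas.sum fun i hi => ⟨measurable_pastAlg (Finset.mem_Ico.1 hi).2, ε, h.abs_le i⟩

/-- A conditional expectation of a variable bounded by ε is bounded by ε almost surely, so clipping
only changes a null set; it makes the bound hold everywhere. -/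
lemma condNext_ae_eq (h : BddOneDep P ε Y) (k : ℕ) :
    condNext P ε Y k =ᵐ[P] P[Y k | pastAlg Y k] := by
  filter_upwards [ae_bdd_abs_condExp_of_ae_bdd_abs (m := pastAlg Y k) (μ := P)
    (ae_of_all P (h.abs_le k))] with ω hω
  have := _root_.abs_le.1 hω
  rw [condNext, min_eq_right this.2, max_eq_right this.1]

lemma integral_mul_next (h : BddOneDep P ε Y) (k : ℕ) {G : Ω → ℝ}
    (hG : BddMeas (pastAlg Y k) G) : ∫ ω, G ω * Y (k + 1) ω ∂P = 0 := by
  rw [integral_mul_of_indep (h.past_le k) (h.future_le (k + 1)) (h.oneDep k) hG.1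
    (measurable_futureAlg le_rfl), h.integral_eq_zero, mul_zero]

variable [IsProbabilityMeasure P]

lemma abs_condNext_le (h : BddOneDep P ε Y) (k : ℕ) (ω : Ω) : |condNext P ε Y k ω| ≤ ε := by
  have := h.bound_nonneg
  rw [_root_.abs_le, condNext]
  exact ⟨le_max_left _ _, max_le (by linarith) (min_le_left _ _)⟩

lemma bddMeas_condNext (h : BddOneDep P ε Y) (k : ℕ) :
    BddMeas (pastAlg Y k) (condNext P ε Y k) :=
  ⟨measurable_const.max (measurable_const.min stronglyMeasurable_condExp.measurable), ε,
    h.abs_condNext_le k⟩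

lemma integral_mul_condNext (h : BddOneDep P ε Y) (k : ℕ) {G : Ω → ℝ}
    (hG : BddMeas (pastAlg Y k) G) :
    ∫ ω, G ω * condNext P ε Y k ω ∂P = ∫ ω, G ω * Y k ω ∂P := by
  have hGY : Integrable (G * Y k) P := ((hG.mono (h.past_le k)).mul (h.bddMeas k)).integrable
  have h1 := condExp_mul_of_stronglyMeasurable_left hG.1.stronglyMeasurable hGY
    (h.bddMeas k).integrable
  calc ∫ ω, G ω * condNext P ε Y k ω ∂P = ∫ ω, P[G * Y k | pastAlg Y k] ω ∂P := by
        refine integral_congr_ae ?_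
        filter_upwards [h1, h.condNext_ae_eq k] with ω h1 h2
        rw [h1, h2, Pi.mul_apply]
    _ = _ := by rw [integral_condExp (h.past_le k)]; rfl

lemma abs_martDiff_le (h : BddOneDep P ε Y) (k : ℕ) (ω : Ω) : |martDiff P ε Y k ω| ≤ 3 * ε := by
  have h1 := _root_.abs_le.1 (h.abs_le k ω)
  have h2 := _root_.abs_le.1 (h.abs_condNext_le k ω)
  have h3 := _root_.abs_le.1 (h.abs_condNext_le (k + 1) ω)
  rw [martDiff, _root_.abs_le]
  constructor <;> linarith

/-- Tested against an F_k-measurable G, the two conditional expectations turn into Y_{k+1} and Y_k.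
The first gives zero by one-dependence, and the second cancels the term Y_k. -/
lemma bddMartDiff (h : BddOneDep P ε Y) :
    BddMartDiff P (pastFiltration h.measurable) (3 * ε) (martDiff P ε Y) where
  bddMeas k := by
    have h1 : BddMeas (pastAlg Y (k + 1)) (Y k) :=
      ⟨measurable_pastAlg (Nat.lt_succ_self k), ε, h.abs_le k⟩
    exact (h1.add (h.bddMeas_condNext (k + 1))).sub
      ((h.bddMeas_condNext k).mono (pastAlg_mono (Nat.le_succ k)))
  abs_le := h.abs_martDiff_le
  orth k G hG := by
    change BddMeas (pastAlg Y k) G at hG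
    have e : ∀ ω, G ω * martDiff P ε Y k ω = G ω * Y k ω + G ω * condNext P ε Y (k + 1) ω -
        G ω * condNext P ε Y k ω := fun ω => by rw [martDiff]; ring
    have hG' := hG.mono (h.past_le k)
    have hG1 := hG.mono (pastAlg_mono (Y := Y) (Nat.le_succ k))
    have i1 := hG'.mul (h.bddMeas k)
    have i2 := hG'.mul ((h.bddMeas_condNext (k + 1)).mono (h.past_le _))
    have i3 := hG'.mul ((h.bddMeas_condNext k).mono (h.past_le _))
    simp_rw [e]
    rw [integral_sub (i1.add i2).integrable i3.integrable, i1.integral_add i2,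
      h.integral_mul_condNext k hG, h.integral_mul_condNext (k + 1) hG1, h.integral_mul_next k hG]
    ring

lemma integral_sum_sq_le (h : BddOneDep P ε Y) {a b : ℕ} (hab : a ≤ b) :
    ∫ ω, (∑ i ∈ Finset.Ico a b, Y i ω) ^ 2 ∂P ≤
      2 * ∑ i ∈ Finset.Ico a b, ∫ ω, martDiff P ε Y i ω ^ 2 ∂P + 8 * ε ^ 2 := by
  have hD := h.bddMartDiff
  have hM := (hD.bddMeas_sum_top a b).pow 2
  have hS := ((h.bddMeas_past_sum a b).mono (h.past_le b)).pow 2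
  rw [← hD.integral_sum_sq hab, ← integral_const_mul]
  calc _ ≤ ∫ ω, (2 * (∑ i ∈ Finset.Ico a b, martDiff P ε Y i ω) ^ 2 + 8 * ε ^ 2) ∂P := by
        refine integral_mono hS.integrable ((hM.const_mul 2).add (.const _)).integrable fun ω => ?_
        simp only [sum_eq_sum_martDiff P ε Y hab]
        have h1 := _root_.abs_le.1 (h.abs_condNext_le a ω)
        have h2 := _root_.abs_le.1 (h.abs_condNext_le b ω)
        set x := ∑ i ∈ Finset.Ico a b, martDiff P ε Y i ω
        set y := condNext P ε Y a ω
        set z := condNext P ε Y b ω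
        have h3 : (y - z) ^ 2 ≤ (2 * ε) ^ 2 := sq_le_sq' (by linarith) (by linarith)
        nlinarith [sq_nonneg (x - (y - z))]
    _ = _ := by
        rw [(hM.const_mul 2).integral_add (.const _)]
        simp

/-- Up to 3ε the martingale sum after i is the sum of the Y_k with k ≥ i + 2, which is independent
of D_i, so the expectation factorizes. This supplies the constant K of the fourth moment bound. -/
lemma integral_martDiff_sq_mul_sq_le (h : BddOneDep P ε Y) {a b i : ℕ} (hai : a ≤ i)
    (hib : i < b) :
    ∫ ω, martDiff P ε Y i ω ^ 2 * (∑ k ∈ Finset.Ico (i + 1) b, martDiff P ε Y k ω) ^ 2 ∂P ≤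
      (4 * ∑ k ∈ Finset.Ico a b, ∫ ω, martDiff P ε Y k ω ^ 2 ∂P + 34 * ε ^ 2) *
        ∫ ω, martDiff P ε Y i ω ^ 2 ∂P := by
  have hε := h.bound_nonneg
  have hD := h.bddMartDiff
  have hdi : 0 ≤ ∫ ω, martDiff P ε Y i ω ^ 2 ∂P := integral_nonneg fun ω => sq_nonneg _
  have hnn : ∀ s : Finset ℕ, 0 ≤ ∑ k ∈ s, ∫ ω, martDiff P ε Y k ω ^ 2 ∂P := fun s =>
    Finset.sum_nonneg fun k _ => integral_nonneg fun ω => sq_nonneg _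
  rcases eq_or_lt_of_le (Nat.succ_le_of_lt hib) with rfl | hlt
  · have := hnn (Finset.Ico a (i + 1))
    simp only [Nat.succ_eq_add_one, Finset.Ico_self, Finset.sum_empty]
    simp only [ne_eq, OfNat.ofNat_ne_zero, not_false_eq_true, zero_pow, mul_zero, integral_zero]
    positivity
  · have hd := (hD.bddMeas i).pow 2
    change BddMeas (pastAlg Y (i + 1)) _ at hd
    have hd' := hd.mono (h.past_le _)
    have hT := (h.bddMeas_future_sum (i + 2) b).pow 2
    have hT' := hT.mono (h.future_le _)
    have hA := (hD.bddMeas_sum_top (i + 1) b).pow 2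
    have i1 := (hd'.mul hT').const_mul 2
    have i2 := hd'.const_mul (18 * ε ^ 2)
    calc _ ≤ ∫ ω, (2 * (martDiff P ε Y i ω ^ 2 * (∑ k ∈ Finset.Ico (i + 2) b, Y k ω) ^ 2) +
          18 * ε ^ 2 * martDiff P ε Y i ω ^ 2) ∂P := by
          refine integral_mono (hd'.mul hA).integrable (i1.add i2).integrable fun ω => ?_
          have e := sum_eq_sum_martDiff P ε Y (Nat.succ_le_of_lt hib) ω
          rw [Finset.sum_eq_sum_Ico_succ_bot hlt] at e
          simp only [Nat.succ_eq_add_one] at e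
          have h1 := _root_.abs_le.1 (h.abs_condNext_le (i + 1) ω)
          have h2 := _root_.abs_le.1 (h.abs_condNext_le b ω)
          have h3 := _root_.abs_le.1 (h.abs_le (i + 1) ω)
          set x := ∑ k ∈ Finset.Ico (i + 1) b, martDiff P ε Y k ω
          set T := ∑ k ∈ Finset.Ico (i + 1 + 1) b, Y k ω
          obtain ⟨u, hu⟩ : ∃ u, u = x - T := ⟨_, rfl⟩
          -- The discrepancy consists of Y_{i+1} and two boundary conditional expectations.
          have h4 : u ^ 2 ≤ (3 * ε) ^ 2 := sq_le_sq' (by linarith) (by linarith)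
          have h5 : x ^ 2 ≤ 2 * T ^ 2 + 18 * ε ^ 2 := by
            have hx : x = T + u := by linarith
            rw [hx]
            nlinarith [sq_nonneg (T - u)]
          have := mul_le_mul_of_nonneg_left h5 (sq_nonneg (martDiff P ε Y i ω))
          change _ * x ^ 2 ≤ 2 * (_ * T ^ 2) + _
          linarith
      _ = (2 * ∫ ω, (∑ k ∈ Finset.Ico (i + 2) b, Y k ω) ^ 2 ∂P + 18 * ε ^ 2) *
          ∫ ω, martDiff P ε Y i ω ^ 2 ∂P := by
          rw [i1.integral_add i2, integral_const_mul, integral_const_mul,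
            integral_mul_of_indep (h.past_le _) (h.future_le _) (h.oneDep (i + 1)) hd.1 hT.1]
          ring
      _ ≤ _ := by
          refine mul_le_mul_of_nonneg_right ?_ hdi
          have h1 := h.integral_sum_sq_le (show i + 2 ≤ b from hlt)
          have h2 : ∑ k ∈ Finset.Ico (i + 2) b, ∫ ω, martDiff P ε Y k ω ^ 2 ∂P ≤
              ∑ k ∈ Finset.Ico a b, ∫ ω, martDiff P ε Y k ω ^ 2 ∂P :=
            Finset.sum_le_sum_of_subset_of_nonneg
              (Finset.Ico_subset_Ico_left (by omega))
              fun k _ _ => integral_nonneg fun ω => sq_nonneg _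
          linarith

lemma integral_martDiff_sum_pow_four_le (h : BddOneDep P ε Y) {a b : ℕ} (hab : a ≤ b) :
    ∫ ω, (∑ i ∈ Finset.Ico a b, martDiff P ε Y i ω) ^ 4 ∂P ≤
      512 * (43 * ε ^ 2 + 4 * ∑ i ∈ Finset.Ico a b, ∫ ω, martDiff P ε Y i ω ^ 2 ∂P) *
        ∑ i ∈ Finset.Ico a b, ∫ ω, martDiff P ε Y i ω ^ 2 ∂P := by
  have hnn : 0 ≤ ∑ k ∈ Finset.Ico a b, ∫ ω, martDiff P ε Y k ω ^ 2 ∂P :=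
    Finset.sum_nonneg fun k _ => integral_nonneg fun ω => sq_nonneg _
  refine (h.bddMartDiff.integral_sum_pow_four_le hab (by positivity) fun i hi =>
    h.integral_martDiff_sq_mul_sq_le (Finset.mem_Ico.1 hi).1 (Finset.mem_Ico.1 hi).2).trans_eq ?_
  ring

end BddOneDep

/-! ### Estimates for characteristic functions -/

lemma norm_exp_I_mul_sub_taylor_le (x : ℝ) :
    ‖Complex.exp (Complex.I * x) - (1 + Complex.I * x - (x : ℂ) ^ 2 / 2)‖ ≤ 4 * |x| ^ 3 := by
  rcases le_or_gt |x| 1 with hx | hx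
  · have h := Complex.norm_exp_sub_sum_le_norm_mul_exp (Complex.I * x) 3
    have hn : ‖Complex.I * (x : ℂ)‖ = |x| := by simp
    have e : ∑ m ∈ Finset.range 3, (Complex.I * (x : ℂ)) ^ m / m.factorial =
        1 + Complex.I * x - (x : ℂ) ^ 2 / 2 := by
      simp only [Finset.sum_range_succ, Finset.sum_range_zero, mul_pow, Complex.I_sq]
      norm_num [Nat.factorial]
      ring
    rw [hn, e] at h
    have h3 : Real.exp |x| ≤ 4 := by
      have := Real.exp_one_lt_d9
      exact (Real.exp_le_exp.2 hx).trans (by linarith)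
    nlinarith [pow_nonneg (abs_nonneg x) 3]
  · have h1 : ‖Complex.exp (Complex.I * x)‖ = 1 := Complex.norm_exp_I_mul_ofReal x
    have h2 : ‖(1 + Complex.I * x - (x : ℂ) ^ 2 / 2)‖ ≤ 1 + |x| + |x| ^ 2 / 2 := by
      refine (norm_sub_le _ _).trans (add_le_add ((norm_add_le _ _).trans ?_) ?_) <;> simp
    have h4 : 1 ≤ |x| ^ 2 := by nlinarith
    have h5 : |x| ^ 2 ≤ |x| ^ 3 := by nlinarith
    have h6 : |x| ≤ |x| ^ 2 := by nlinarith
    refine (norm_sub_le _ _).trans ?_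
    linarith

lemma abs_exp_neg_sub_le {u : ℝ} (hu : 0 ≤ u) : |Real.exp (-u) - (1 - u)| ≤ u ^ 2 := by
  have h1 := Real.add_one_le_exp (-u)
  have h2 := Real.add_one_le_exp u
  have h3 : Real.exp (-u) * Real.exp u = 1 := by rw [← Real.exp_add]; simp
  have h4 := Real.exp_pos (-u)
  have h5 : Real.exp (-u) * (1 + u) ≤ 1 := by nlinarith
  rw [abs_le]
  constructor
  · nlinarith [sq_nonneg u]
  · have h6 : 0 ≤ u ^ 3 := by positivity
    -- Uses (1 - u + u²)(1 + u) = 1 + u³ ≥ 1.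
    have h7 : (Real.exp (-u) - (1 - u + u ^ 2)) * (1 + u) ≤ 0 := by nlinarith
    have := nonpos_of_mul_nonpos_left h7 (by linarith)
    linarith

/-- The characteristic function of a random variable. -/
noncomputable def chf {Ω : Type*} [MeasurableSpace Ω] (P : Measure Ω) (f : Ω → ℝ) (t : ℝ) : ℂ :=
  ∫ ω, Complex.exp (Complex.I * ((t * f ω : ℝ) : ℂ)) ∂P

section

variable {Ω : Type*} [mΩ : MeasurableSpace Ω] {P : Measure Ω} {f g : Ω → ℝ} {t : ℝ}

lemma chf_add_of_indepFun (hf : Measurable f) (hg : Measurable g) (h : IndepFun f g P) :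
    chf P (fun ω => f ω + g ω) t = chf P f t * chf P g t := by
  have := h.integral_fun_comp_mul_comp (f := fun x => Complex.exp (Complex.I * ((t * x : ℝ) : ℂ)))
    (g := fun x => Complex.exp (Complex.I * ((t * x : ℝ) : ℂ))) hf.aemeasurable hg.aemeasurable
    (Measurable.aestronglyMeasurable (by fun_prop)) (Measurable.aestronglyMeasurable (by fun_prop))
  rw [chf, chf, chf, ← this]
  congr 1 with ω
  rw [← Complex.exp_add]
  push_cast
  ring_nf

variable [IsProbabilityMeasure P]

lemma integrable_chf (hf : Measurable f) :
    Integrable (fun ω => Complex.exp (Complex.I * ((t * f ω : ℝ) : ℂ))) P := by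
  refine Integrable.of_bound (Measurable.aestronglyMeasurable (by fun_prop)) 1
    (ae_of_all _ fun ω => ?_)
  exact (Complex.norm_exp_I_mul_ofReal _).le

lemma norm_chf_le_one : ‖chf P f t‖ ≤ 1 := by
  refine (norm_integral_le_of_norm_le_const (C := 1) (ae_of_all _ fun ω => ?_)).trans (by simp)
  exact (Complex.norm_exp_I_mul_ofReal _).le

lemma norm_exp_sub_exp_le (x y : ℝ) :
    ‖Complex.exp (Complex.I * (x : ℂ)) - Complex.exp (Complex.I * (y : ℂ))‖ ≤ |x - y| := by
  have e : Complex.exp (Complex.I * (x : ℂ)) - Complex.exp (Complex.I * (y : ℂ)) =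
      Complex.exp (Complex.I * (y : ℂ)) * (Complex.exp (Complex.I * ((x - y : ℝ) : ℂ)) - 1) := by
    rw [mul_sub, ← Complex.exp_add]
    push_cast
    ring_nf
  rw [e, norm_mul, Complex.norm_exp_I_mul_ofReal, one_mul]
  exact Real.norm_exp_I_mul_ofReal_sub_one_le

lemma norm_chf_sub_le (hf : Measurable f) (hg : Measurable g)
    (hfg : Integrable (fun ω => f ω - g ω) P) :
    ‖chf P f t - chf P g t‖ ≤ |t| * ∫ ω, |f ω - g ω| ∂P := by
  rw [chf, chf, ← integral_sub (integrable_chf hf) (integrable_chf hg), ← integral_const_mul]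
  refine norm_integral_le_of_norm_le (hfg.abs.const_mul _) (ae_of_all _ fun ω => ?_)
  refine (norm_exp_sub_exp_le _ _).trans_eq ?_
  rw [← mul_sub, abs_mul]

lemma norm_chf_sub_le_of_abs_le {ε : ℝ} (hf : Measurable f) (hg : Measurable g)
    (hfg : ∀ ω, |f ω - g ω| ≤ ε) : ‖chf P f t - chf P g t‖ ≤ |t| * ε := by
  have hi : Integrable (fun ω => f ω - g ω) P :=
    Integrable.of_bound (hf.sub hg).aestronglyMeasurable ε (ae_of_all _ hfg)
  refine (norm_chf_sub_le hf hg hi).trans (mul_le_mul_of_nonneg_left ?_ (abs_nonneg t))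
  calc ∫ ω, |f ω - g ω| ∂P ≤ ∫ _, ε ∂P := integral_mono hi.abs (integrable_const _) hfg
    _ = ε := by simp

lemma norm_chf_sub_exp_le (hf : BddMeas mΩ f) (h0 : ∫ ω, f ω ∂P = 0) :
    ‖chf P f t - (Real.exp (-(t ^ 2 * (∫ ω, f ω ^ 2 ∂P) / 2)) : ℝ)‖ ≤
      4 * |t| ^ 3 * ∫ ω, |f ω| ^ 3 ∂P + t ^ 4 * (∫ ω, f ω ^ 2 ∂P) ^ 2 / 4 := by
  set v := ∫ ω, f ω ^ 2 ∂P with hv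
  have hv0 : 0 ≤ v := integral_nonneg fun ω => sq_nonneg _
  have habs : BddMeas mΩ (fun ω => |f ω|) :=
    ⟨hf.1.abs, hf.2.imp fun C h ω => by simpa using h ω⟩
  have i1 : Integrable (fun ω => ((t * f ω : ℝ) : ℂ)) P := (hf.const_mul t).integrable.ofReal
  have i2 : Integrable (fun ω => (((t * f ω) ^ 2 : ℝ) : ℂ)) P :=
    ((hf.const_mul t).pow 2).integrable.ofReal
  have j1 : Integrable (fun ω => (1 : ℂ) + Complex.I * ((t * f ω : ℝ) : ℂ)) P :=
    (integrable_const _).add (i1.const_mul _)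
  have j2 : Integrable (fun ω => (((t * f ω) ^ 2 : ℝ) : ℂ) / 2) P := i2.div_const 2
  have e : ∫ ω, ((1 : ℂ) + Complex.I * ((t * f ω : ℝ) : ℂ) - (((t * f ω) ^ 2 : ℝ) : ℂ) / 2) ∂P =
      ((1 - t ^ 2 * v / 2 : ℝ) : ℂ) := by
    rw [integral_sub j1 j2, integral_add (integrable_const _) (i1.const_mul _),
      integral_const_mul, integral_div, integral_complex_ofReal, integral_complex_ofReal,
      integral_const_mul, h0]
    simp_rw [mul_pow]
    rw [integral_const_mul, ← hv]
    simp
  have h1 : ‖chf P f t - ((1 - t ^ 2 * v / 2 : ℝ) : ℂ)‖ ≤ 4 * |t| ^ 3 * ∫ ω, |f ω| ^ 3 ∂P := by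
    have j3 : Integrable (fun ω => (1 : ℂ) + Complex.I * ((t * f ω : ℝ) : ℂ) -
      (((t * f ω) ^ 2 : ℝ) : ℂ) / 2) P := j1.sub j2
    rw [← e, chf, ← integral_sub (integrable_chf hf.1) j3, ← integral_const_mul]
    refine norm_integral_le_of_norm_le ((habs.pow 3).const_mul _).integrable
      (ae_of_all _ fun ω => ?_)
    have := norm_exp_I_mul_sub_taylor_le (t * f ω)
    rw [abs_mul, mul_pow, ← mul_assoc] at this
    simpa using this
  have h2 : ‖((1 - t ^ 2 * v / 2 : ℝ) : ℂ) - (Real.exp (-(t ^ 2 * v / 2)) : ℝ)‖ ≤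
      t ^ 4 * v ^ 2 / 4 := by
    rw [← Complex.ofReal_sub, Complex.norm_real, norm_sub_rev]
    refine (abs_exp_neg_sub_le (by positivity)).trans_eq ?_
    ring
  exact (norm_sub_le_norm_sub_add_norm_sub _ _ _).trans (add_le_add h1 h2)

/-- Integrate 2|x|³ ≤ s x² + x⁴/s. With s = √η it turns second and fourth moments into a third
moment of order η^(3/2). -/
lemma integral_abs_pow_three_le (hf : BddMeas mΩ f) {s : ℝ} (hs : 0 < s) :
    ∫ ω, |f ω| ^ 3 ∂P ≤ (s * ∫ ω, f ω ^ 2 ∂P + s⁻¹ * ∫ ω, f ω ^ 4 ∂P) / 2 := by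
  have habs : BddMeas mΩ (fun ω => |f ω|) :=
    ⟨hf.1.abs, hf.2.imp fun C h ω => by simpa using h ω⟩
  have i1 := (hf.pow 2).const_mul s
  have i2 := (hf.pow 4).const_mul s⁻¹
  rw [← integral_const_mul, ← integral_const_mul, ← i1.integral_add i2, ← integral_div]
  refine integral_mono (habs.pow 3).integrable ((i1.add i2).integrable.div_const 2) fun ω => ?_
  dsimp only
  have e4 : f ω ^ 4 = |f ω| ^ 4 := by rw [← abs_pow, abs_of_nonneg (by positivity)]
  rw [← sq_abs (f ω), e4]
  set x := |f ω|
  have h1 : 0 ≤ s⁻¹ * (x ^ 2 - s * x) ^ 2 := by positivity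
  have h2 : s⁻¹ * (x ^ 2 - s * x) ^ 2 = s⁻¹ * x ^ 4 + s * x ^ 2 - 2 * x ^ 3 := by
    field_simp
    ring
  linarith

end

/-! ### Block decomposition for bounded one-dependent sequences -/

/-- The error bound for one block in the characteristic function estimate. -/
noncomputable def blockError (t ε η : ℝ) : ℝ :=
  4 * |t| * ε + |t| ^ 3 * (10 ^ 6 * (η * √η)) + 25 * t ^ 4 * η ^ 2

namespace BddOneDep

variable {Ω : Type*} [mΩ : MeasurableSpace Ω] {P : Measure Ω} [IsProbabilityMeasure P] {ε : ℝ}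
  {Y : ℕ → Ω → ℝ}

lemma norm_chf_martDiff_sum_sub_le (h : BddOneDep P ε Y) {a b : ℕ} (hab : a ≤ b) {η : ℝ}
    (hη : 0 < η) (hε : ε ^ 2 ≤ η)
    (hv : ∑ i ∈ Finset.Ico a b, ∫ ω, martDiff P ε Y i ω ^ 2 ∂P ≤ 10 * η) (t : ℝ) :
    ‖chf P (fun ω => ∑ i ∈ Finset.Ico a b, martDiff P ε Y i ω) t -
      (Real.exp (-(t ^ 2 * (∑ i ∈ Finset.Ico a b, ∫ ω, martDiff P ε Y i ω ^ 2 ∂P) / 2)) : ℝ)‖ ≤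
      |t| ^ 3 * (10 ^ 6 * (η * √η)) + 25 * t ^ 4 * η ^ 2 := by
  have hD := h.bddMartDiff
  have hM := hD.bddMeas_sum_top a b
  have h4 := h.integral_martDiff_sum_pow_four_le hab
  have hsq := hD.integral_sum_sq hab
  have h0 : ∫ ω, ∑ i ∈ Finset.Ico a b, martDiff P ε Y i ω ∂P = 0 := by
    simpa using hD.integral_mul_sum_eq_zero b (BddMeas.const (1 : ℝ))
  have hs := Real.sqrt_pos.2 hη
  have hss := Real.mul_self_sqrt hη.le
  have h3 := integral_abs_pow_three_le (P := P) hM hs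
  refine (norm_chf_sub_exp_le hM h0 (t := t)).trans' (le_of_eq (by rw [hsq])) |>.trans ?_
  rw [hsq] at h3 ⊢
  set v := ∑ i ∈ Finset.Ico a b, ∫ ω, martDiff P ε Y i ω ^ 2 ∂P
  have hv0 : 0 ≤ v := Finset.sum_nonneg fun i _ => integral_nonneg fun ω => sq_nonneg _
  have h5 : ∫ ω, (∑ i ∈ Finset.Ico a b, martDiff P ε Y i ω) ^ 4 ∂P ≤ 424960 * η ^ 2 := by
    refine h4.trans ?_
    have : 512 * (43 * ε ^ 2 + 4 * v) ≤ 512 * 83 * η := by linarith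
    calc _ ≤ 512 * 83 * η * (10 * η) := mul_le_mul this hv hv0 (by positivity)
      _ = _ := by ring
  have h6 : (√η)⁻¹ * ∫ ω, (∑ i ∈ Finset.Ico a b, martDiff P ε Y i ω) ^ 4 ∂P ≤
      424960 * (η * √η) := by
    rw [inv_mul_le_iff₀ hs]
    refine h5.trans_eq ?_
    rw [show √η * (424960 * (η * √η)) = 424960 * (η * (√η * √η)) by ring, hss]
    ring
  have h7 : √η * v ≤ 10 * (η * √η) := by nlinarith
  -- The constant is 4 · (10 + 424960) / 2 = 849940, rounded up.
  have h8 : 4 * ∫ ω, |∑ i ∈ Finset.Ico a b, martDiff P ε Y i ω| ^ 3 ∂P ≤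
      10 ^ 6 * (η * √η) := by
    have : 0 ≤ η * √η := by positivity
    linarith
  have h9 : v ^ 2 ≤ (10 * η) ^ 2 := pow_le_pow_left₀ hv0 hv 2
  have h10 := mul_le_mul_of_nonneg_left h8 (pow_nonneg (abs_nonneg t) 3)
  have h11 := mul_le_mul_of_nonneg_left h9 (show 0 ≤ t ^ 4 / 4 by positivity)
  linarith

/-- Omitting Y_a costs |t| ε and makes the sums before and after it independent. Replacing the later
sum by the martingale sum over the block costs 3|t| ε more, and the Gaussian approximation of that
sum accounts for the rest of `blockError`. -/
lemma norm_chf_sum_sub_mul_le (h : BddOneDep P ε Y) {a b : ℕ} (hab : a < b) {η : ℝ}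
    (hη : 0 < η) (hε : ε ^ 2 ≤ η)
    (hv : ∑ i ∈ Finset.Ico a b, ∫ ω, martDiff P ε Y i ω ^ 2 ∂P ≤ 10 * η) (t : ℝ) :
    ‖chf P (fun ω => ∑ i ∈ Finset.Ico 0 b, Y i ω) t -
      chf P (fun ω => ∑ i ∈ Finset.Ico 0 a, Y i ω) t *
      (Real.exp (-(t ^ 2 * (∑ i ∈ Finset.Ico a b, ∫ ω, martDiff P ε Y i ω ^ 2 ∂P) / 2)) : ℝ)‖ ≤
      blockError t ε η := by
  have hS : ∀ a b, Measurable (fun ω => ∑ i ∈ Finset.Ico a b, Y i ω) := fun a b =>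
    ((h.bddMeas_past_sum a b).mono (h.past_le b)).1
  have hM := h.bddMartDiff.bddMeas_sum_top a b
  have h1 : ‖chf P (fun ω => ∑ i ∈ Finset.Ico 0 b, Y i ω) t -
      chf P (fun ω => ∑ i ∈ Finset.Ico 0 a, Y i ω + ∑ i ∈ Finset.Ico (a + 1) b, Y i ω) t‖ ≤
      |t| * ε := by
    refine norm_chf_sub_le_of_abs_le (hS _ _) ((hS _ _).add (hS _ _)) fun ω => ?_
    rw [← Finset.sum_Ico_consecutive _ (Nat.zero_le a) hab.le,
      Finset.sum_eq_sum_Ico_succ_bot hab]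
    convert h.abs_le a ω using 2
    ring
  rw [chf_add_of_indepFun (hS _ _) (hS _ _) ((h.oneDep a).indepFun
    (h.bddMeas_past_sum 0 a).1 (h.bddMeas_future_sum (a + 1) b).1)] at h1
  have h2 : ‖chf P (fun ω => ∑ i ∈ Finset.Ico (a + 1) b, Y i ω) t -
      chf P (fun ω => ∑ i ∈ Finset.Ico a b, martDiff P ε Y i ω) t‖ ≤ |t| * (3 * ε) := by
    refine norm_chf_sub_le_of_abs_le (hS _ _) hM.1 fun ω => ?_
    have e := sum_eq_sum_martDiff P ε Y hab.le ω
    rw [Finset.sum_eq_sum_Ico_succ_bot hab] at e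
    have h1 := _root_.abs_le.1 (h.abs_condNext_le a ω)
    have h2 := _root_.abs_le.1 (h.abs_condNext_le b ω)
    have h3 := _root_.abs_le.1 (h.abs_le a ω)
    rw [_root_.abs_le]
    constructor <;> linarith
  have h3 := h.norm_chf_martDiff_sum_sub_le hab.le hη hε hv t
  have h4 := (norm_sub_le_norm_sub_add_norm_sub _ _ _).trans (add_le_add h2 h3)
  have h5 := mul_le_mul_of_nonneg_right
    (norm_chf_le_one (P := P) (f := fun ω => ∑ i ∈ Finset.Ico 0 a, Y i ω) (t := t))
    ((norm_nonneg _).trans h4)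
  have h6 : ‖chf P (fun ω => ∑ i ∈ Finset.Ico 0 a, Y i ω) t *
      chf P (fun ω => ∑ i ∈ Finset.Ico (a + 1) b, Y i ω) t -
      chf P (fun ω => ∑ i ∈ Finset.Ico 0 a, Y i ω) t *
      (Real.exp (-(t ^ 2 * (∑ i ∈ Finset.Ico a b, ∫ ω, martDiff P ε Y i ω ^ 2 ∂P) / 2)) : ℝ)‖ ≤
      |t| * (3 * ε) + (|t| ^ 3 * (10 ^ 6 * (η * √η)) + 25 * t ^ 4 * η ^ 2) := by
    rw [← mul_sub, norm_mul]
    exact (mul_le_mul_of_nonneg_left h4 (norm_nonneg _)).trans (by linarith)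
  refine (norm_sub_le_norm_sub_add_norm_sub _ _ _).trans ((add_le_add h1 h6).trans_eq ?_)
  rw [blockError]
  ring

/-- A quantitative central limit theorem for bounded one-dependent variables. -/
lemma norm_chf_sum_sub_exp_le (h : BddOneDep P ε Y) {η : ℝ} (hη : 0 < η) (hε : ε ^ 2 ≤ η) (t : ℝ)
    (b : ℕ) :
    ‖chf P (fun ω => ∑ i ∈ Finset.Ico 0 b, Y i ω) t -
      (Real.exp (-(t ^ 2 * (∑ i ∈ Finset.Ico 0 b, ∫ ω, martDiff P ε Y i ω ^ 2 ∂P) / 2)) : ℝ)‖ ≤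
      ((∑ i ∈ Finset.Ico 0 b, ∫ ω, martDiff P ε Y i ω ^ 2 ∂P) / η + 1) * blockError t ε η := by
  induction b using Nat.strong_induction_on with
  | _ b ih =>
  have hε0 := h.bound_nonneg
  have hδ : 0 ≤ blockError t ε η := by rw [blockError]; positivity
  have hd : ∀ i, 0 ≤ ∫ ω, martDiff P ε Y i ω ^ 2 ∂P := fun i =>
    integral_nonneg fun ω => sq_nonneg _
  have hd9 : ∀ i, ∫ ω, martDiff P ε Y i ω ^ 2 ∂P ≤ 9 * η := fun i => by
    calc ∫ ω, martDiff P ε Y i ω ^ 2 ∂P ≤ ∫ _, (3 * ε) ^ 2 ∂P :=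
          integral_mono ((h.bddMartDiff.bddMeas_top i).pow 2).integrable (integrable_const _)
            fun ω => sq_le_sq' (_root_.abs_le.1 (h.abs_martDiff_le i ω)).1
              (_root_.abs_le.1 (h.abs_martDiff_le i ω)).2
      _ = 9 * ε ^ 2 := by simp; ring
      _ ≤ _ := by linarith
  have hV : ∀ a b, 0 ≤ ∑ i ∈ Finset.Ico a b, ∫ ω, martDiff P ε Y i ω ^ 2 ∂P := fun a b =>
    Finset.sum_nonneg fun i _ => hd i
  rcases Nat.eq_zero_or_pos b with rfl | hb
  · simpa [chf] using hδ
  by_cases hsmall : ∑ i ∈ Finset.Ico 0 b, ∫ ω, martDiff P ε Y i ω ^ 2 ∂P ≤ 10 * η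
  · have h1 := h.norm_chf_sum_sub_mul_le hb hη hε hsmall t
    have e : chf P (fun ω => ∑ i ∈ Finset.Ico 0 0, Y i ω) t = 1 := by simp [chf]
    rw [e, one_mul] at h1
    refine h1.trans (le_mul_of_one_le_left hδ ?_)
    have : 0 ≤ (∑ i ∈ Finset.Ico 0 b, ∫ ω, martDiff P ε Y i ω ^ 2 ∂P) / η :=
      div_nonneg (hV _ _) hη.le
    linarith
  · rw [not_le] at hsmall
    -- Take the largest a for which the last block has variance at least η: without index a it is
    -- below η, and a single term contributes at most 9η.
    obtain ⟨a, hab, ha1, ha2⟩ : ∃ a < b,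
        η ≤ ∑ i ∈ Finset.Ico a b, ∫ ω, martDiff P ε Y i ω ^ 2 ∂P ∧
        ∑ i ∈ Finset.Ico a b, ∫ ω, martDiff P ε Y i ω ^ 2 ∂P ≤ 10 * η := by
      set p : ℕ → Prop := fun a => η ≤ ∑ i ∈ Finset.Ico a b, ∫ ω, martDiff P ε Y i ω ^ 2 ∂P
      classical
      have hp0 : p 0 := by change η ≤ _; linarith
      have hpa : p (Nat.findGreatest p b) := Nat.findGreatest_spec (Nat.zero_le b) hp0
      have hne : Nat.findGreatest p b ≠ b := fun he => by
        rw [he] at hpa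
        simp only [p, Finset.Ico_self, Finset.sum_empty] at hpa
        linarith
      have hlt : Nat.findGreatest p b < b := lt_of_le_of_ne (Nat.findGreatest_le b) hne
      refine ⟨_, hlt, hpa, ?_⟩
      have hn : ¬ p (Nat.findGreatest p b + 1) :=
        Nat.findGreatest_is_greatest (Nat.lt_succ_self _) hlt
      simp only [p, not_le] at hn
      have h9 := hd9 (Nat.findGreatest p b)
      rw [Finset.sum_eq_sum_Ico_succ_bot hlt]
      linarith
    have h1 := h.norm_chf_sum_sub_mul_le hab hη hε ha2 t
    have h2 := ih a hab
    rw [← Finset.sum_Ico_consecutive _ (Nat.zero_le a) hab.le]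
    set V := ∑ i ∈ Finset.Ico 0 a, ∫ ω, martDiff P ε Y i ω ^ 2 ∂P
    set v := ∑ i ∈ Finset.Ico a b, ∫ ω, martDiff P ε Y i ω ^ 2 ∂P
    have h3 : ‖chf P (fun ω => ∑ i ∈ Finset.Ico 0 a, Y i ω) t *
        (Real.exp (-(t ^ 2 * v / 2)) : ℝ) - (Real.exp (-(t ^ 2 * (V + v) / 2)) : ℝ)‖ ≤
        (V / η + 1) * blockError t ε η := by
      have e : ((Real.exp (-(t ^ 2 * (V + v) / 2)) : ℝ) : ℂ) =
          (Real.exp (-(t ^ 2 * V / 2)) : ℝ) * (Real.exp (-(t ^ 2 * v / 2)) : ℝ) := by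
        rw [← Complex.ofReal_mul, ← Real.exp_add]
        ring_nf
      rw [e, ← sub_mul, norm_mul]
      refine (mul_le_of_le_one_right (norm_nonneg _) ?_).trans h2
      rw [Complex.norm_real, Real.norm_of_nonneg (Real.exp_pos _).le, Real.exp_le_one_iff]
      have : 0 ≤ t ^ 2 * v := mul_nonneg (sq_nonneg t) (hV a b)
      linarith
    refine (norm_sub_le_norm_sub_add_norm_sub _ _ _).trans ((add_le_add h1 h3).trans ?_)
    -- Each block uses up at least η of the variance, which pays for one more `blockError`.
    have h4 : 1 ≤ v / η := (one_le_div hη).2 ha1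
    rw [add_div]
    nlinarith

/-- Both boundary terms vanish: F_0 is trivial and Y_0 is centered, while Y_n = 0 has zero
conditional expectation. -/
lemma sum_integral_martDiff_sq (h : BddOneDep P ε Y) {n : ℕ} (hn : ∀ ω, Y n ω = 0) :
    ∑ i ∈ Finset.Ico 0 n, ∫ ω, martDiff P ε Y i ω ^ 2 ∂P =
      ∫ ω, (∑ i ∈ Finset.Ico 0 n, Y i ω) ^ 2 ∂P := by
  rw [← h.bddMartDiff.integral_sum_sq (Nat.zero_le n)]
  have h0 : condNext P ε Y 0 =ᵐ[P] 0 := by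
    filter_upwards [h.condNext_ae_eq 0] with ω hω
    rw [hω, pastAlg_zero, condExp_bot, h.integral_eq_zero, Pi.zero_apply]
  have hn : condNext P ε Y n =ᵐ[P] 0 := by
    have : Y n = 0 := funext hn
    filter_upwards [h.condNext_ae_eq n] with ω hω
    rw [hω, this, condExp_zero]
  refine integral_congr_ae ?_
  filter_upwards [h0, hn] with ω h0 hn
  rw [sum_eq_sum_martDiff P ε Y (Nat.zero_le n) ω, h0, hn]
  simp

end BddOneDep

/-! ### Variance bound and truncation -/

lemma OneDep.comp {Ω : Type*} [MeasurableSpace Ω] {Y : ℕ → Ω → ℝ} {P : Measure Ω}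
    (h : OneDep Y P) {g : ℕ → ℝ → ℝ} (hg : ∀ i, Measurable (g i)) :
    OneDep (fun i ω => g i (Y i ω)) P := fun k =>
  indep_of_indep_of_le (h k)
    (pastAlg_le fun i hi => (hg i).comp (measurable_pastAlg hi))
    (futureAlg_le fun i hi => (hg i).comp (measurable_futureAlg hi))

section

variable {Ω : Type*} [mΩ : MeasurableSpace Ω] {P : Measure Ω}

/-- A new term correlates only with its predecessor, and 2 R_k R_{k+1} ≤ R_k² + R_{k+1}². The last
term thus has coefficient 2, rising to 3 at the next step. -/
lemma OneDep.integral_sum_sq_succ_le {R : ℕ → Ω → ℝ} (h : OneDep R P)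
    (hm : ∀ i, Measurable (R i)) (h2 : ∀ i, MemLp (R i) 2 P) (h0 : ∀ i, ∫ ω, R i ω ∂P = 0)
    (k : ℕ) :
    ∫ ω, (∑ i ∈ Finset.Ico 0 (k + 1), R i ω) ^ 2 ∂P ≤
      3 * ∑ i ∈ Finset.Ico 0 k, ∫ ω, R i ω ^ 2 ∂P + 2 * ∫ ω, R k ω ^ 2 ∂P := by
  have hS : ∀ n, MemLp (fun ω => ∑ i ∈ Finset.Ico 0 n, R i ω) 2 P := fun n =>
    memLp_finsetSum _ fun i _ => h2 i
  induction k with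
  | zero =>
    have : 0 ≤ ∫ ω, R 0 ω ^ 2 ∂P := integral_nonneg fun ω => sq_nonneg _
    simp
    linarith
  | succ k ih =>
    have hind : ∫ ω, (∑ i ∈ Finset.Ico 0 k, R i ω) * R (k + 1) ω ∂P = 0 := by
      rw [integral_mul_of_indep (pastAlg_le fun i _ => hm i) (futureAlg_le fun i _ => hm i) (h k)
        (Finset.measurable_sum (Finset.Ico 0 k) fun i hi =>
          measurable_pastAlg (Finset.mem_Ico.1 hi).2)
        (measurable_futureAlg le_rfl), h0, mul_zero]
    have i1 : Integrable (fun ω => (∑ i ∈ Finset.Ico 0 (k + 1), R i ω) ^ 2) P :=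
      (hS (k + 1)).integrable_sq
    have i2 : Integrable (fun ω => 2 * ((∑ i ∈ Finset.Ico 0 k, R i ω) * R (k + 1) ω)) P :=
      ((hS k).integrable_mul (h2 (k + 1))).const_mul 2
    have i3 : Integrable (fun ω => R k ω ^ 2) P := (h2 k).integrable_sq
    have i4 : Integrable (fun ω => 2 * R (k + 1) ω ^ 2) P := (h2 (k + 1)).integrable_sq.const_mul 2
    have i12 : Integrable (fun ω => (∑ i ∈ Finset.Ico 0 (k + 1), R i ω) ^ 2 +
      2 * ((∑ i ∈ Finset.Ico 0 k, R i ω) * R (k + 1) ω)) P := i1.add i2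
    have i34 : Integrable (fun ω => R k ω ^ 2 + 2 * R (k + 1) ω ^ 2) P := i3.add i4
    calc ∫ ω, (∑ i ∈ Finset.Ico 0 (k + 1 + 1), R i ω) ^ 2 ∂P
        ≤ ∫ ω, ((∑ i ∈ Finset.Ico 0 (k + 1), R i ω) ^ 2 +
            2 * ((∑ i ∈ Finset.Ico 0 k, R i ω) * R (k + 1) ω) +
            (R k ω ^ 2 + 2 * R (k + 1) ω ^ 2)) ∂P := by
          refine integral_mono (hS (k + 1 + 1)).integrable_sq (i12.add i34) fun ω => ?_
          simp only [Finset.sum_Ico_succ_top (Nat.zero_le _)]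
          nlinarith [sq_nonneg (R k ω - R (k + 1) ω)]
      _ = ∫ ω, (∑ i ∈ Finset.Ico 0 (k + 1), R i ω) ^ 2 ∂P +
            (∫ ω, R k ω ^ 2 ∂P + 2 * ∫ ω, R (k + 1) ω ^ 2 ∂P) := by
          rw [integral_add i12 i34, integral_add i1 i2, integral_add i3 i4, integral_const_mul,
            integral_const_mul, hind]
          ring
      _ ≤ _ := by
          rw [Finset.sum_Ico_succ_top (Nat.zero_le _)]
          linarith

lemma OneDep.integral_sum_sq_le {R : ℕ → Ω → ℝ} (h : OneDep R P)
    (hm : ∀ i, Measurable (R i)) (h2 : ∀ i, MemLp (R i) 2 P) (h0 : ∀ i, ∫ ω, R i ω ∂P = 0)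
    (n : ℕ) :
    ∫ ω, (∑ i ∈ Finset.Ico 0 n, R i ω) ^ 2 ∂P ≤
      3 * ∑ i ∈ Finset.Ico 0 n, ∫ ω, R i ω ^ 2 ∂P := by
  cases n with
  | zero => simp
  | succ k =>
    refine (h.integral_sum_sq_succ_le hm h2 h0 k).trans ?_
    have : 0 ≤ ∫ ω, R k ω ^ 2 ∂P := integral_nonneg fun ω => sq_nonneg _
    rw [Finset.sum_Ico_succ_top (Nat.zero_le _)]
    linarith

end

/-- Truncation of a real number to zero outside `(-ε, ε]`. -/
noncomputable def trunc (ε x : ℝ) : ℝ := (Set.Ioc (-ε) ε).indicator id x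

lemma measurable_trunc (ε : ℝ) : Measurable (trunc ε) := measurable_id.indicator measurableSet_Ioc

lemma abs_trunc_le {ε : ℝ} (hε : 0 ≤ ε) (x : ℝ) : |trunc ε x| ≤ ε := by
  rw [trunc, Set.indicator]
  split_ifs with h
  · exact abs_le.2 ⟨h.1.le, h.2⟩
  · simpa using hε

lemma sub_trunc_sq_le {ε r : ℝ} (hε : 0 < ε) (hr : 2 < r) (x : ℝ) :
    (x - trunc ε x) ^ 2 ≤ ε ^ (2 - r) * |x| ^ r := by
  rw [trunc, Set.indicator]
  split_ifs with h
  · rw [id, sub_self, zero_pow two_ne_zero]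
    positivity
  · have hx : ε ≤ |x| := by
      by_contra! hlt
      exact h ⟨(abs_lt.1 hlt).1, (abs_lt.1 hlt).2.le⟩
    have hx0 : 0 < |x| := hε.trans_le hx
    have h1 : |x| ^ (2 - r) ≤ ε ^ (2 - r) :=
      Real.rpow_le_rpow_of_nonpos hε hx (by linarith)
    calc (x - 0) ^ 2 = |x| ^ (2 - r) * |x| ^ r := by
          rw [← Real.rpow_add hx0, sub_add_cancel, sub_zero, ← sq_abs]
          norm_cast
      _ ≤ _ := mul_le_mul_of_nonneg_right h1 (by positivity)

section

variable {Ω : Type*} [mΩ : MeasurableSpace Ω] {P : Measure Ω} [IsProbabilityMeasure P]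

lemma abs_integral_trunc_le {f : Ω → ℝ} {ε : ℝ} (hε : 0 ≤ ε) :
    |∫ ω, trunc ε (f ω) ∂P| ≤ ε := by
  have := norm_integral_le_of_norm_le_const (μ := P) (f := fun ω => trunc ε (f ω)) (C := ε)
    (ae_of_all _ fun ω => by simpa using abs_trunc_le hε (f ω))
  simpa using this

/-- The truncated and centered variables of a one-dependent sequence. -/
lemma OneDep.bddOneDep_trunc {W : ℕ → Ω → ℝ} (h : OneDep W P) (hm : ∀ i, Measurable (W i))
    {ε : ℝ} (hε : 0 ≤ ε) :
    BddOneDep P (2 * ε) (fun i ω => trunc ε (W i ω) - ∫ ω', trunc ε (W i ω') ∂P) where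
  measurable i := ((measurable_trunc ε).comp (hm i)).sub_const _
  abs_le i ω := by
    have h1 := abs_le.1 (abs_trunc_le hε (W i ω))
    have h2 := abs_le.1 (abs_integral_trunc_le (P := P) (f := W i) hε)
    rw [abs_le]
    constructor <;> linarith
  integral_eq_zero i := by
    have : Integrable (fun ω => trunc ε (W i ω)) P :=
      Integrable.of_bound ((measurable_trunc ε).comp (hm i)).aestronglyMeasurable ε
        (ae_of_all _ fun ω => abs_trunc_le hε (W i ω))
    rw [integral_sub this (integrable_const _)]
    simp
  oneDep := h.comp (g := fun i x => trunc ε x - ∫ ω', trunc ε (W i ω') ∂P)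
    fun i => (measurable_trunc ε).sub_const _

/-- The error made by truncating a one-dependent sequence. -/
lemma OneDep.integral_sub_trunc_sq_le {W : ℕ → Ω → ℝ} (h : OneDep W P)
    (hm : ∀ i, Measurable (W i)) {r : ℝ} (hr : 2 < r) (h2 : ∀ i, MemLp (W i) 2 P)
    (hWr : ∀ i, Integrable (fun ω => |W i ω| ^ r) P)
    (h0 : ∀ i, ∫ ω, W i ω ∂P = 0) {ε : ℝ} (hε : 0 < ε) (n : ℕ) :
    ∫ ω, (∑ i ∈ Finset.Ico 0 n, W i ω -
      ∑ i ∈ Finset.Ico 0 n, (trunc ε (W i ω) - ∫ ω', trunc ε (W i ω') ∂P)) ^ 2 ∂P ≤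
      3 * (ε ^ (2 - r) * ∑ i ∈ Finset.Ico 0 n, ∫ ω, |W i ω| ^ r ∂P) := by
  have hB := h.bddOneDep_trunc hm hε.le
  simp_rw [← Finset.sum_sub_distrib]
  have hR2 : ∀ i, MemLp (fun ω => W i ω - (trunc ε (W i ω) - ∫ ω', trunc ε (W i ω') ∂P)) 2 P :=
    fun i => (h2 i).sub (MemLp.of_bound (hB.measurable i).aestronglyMeasurable (2 * ε)
      (ae_of_all _ (hB.abs_le i)))
  refine (OneDep.integral_sum_sq_le
    (h.comp (g := fun i x => x - (trunc ε x - ∫ ω', trunc ε (W i ω') ∂P))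
      fun i => measurable_id.sub ((measurable_trunc ε).sub_const _))
    (fun i => (hm i).sub (hB.measurable i)) hR2
    (fun i => by
      rw [integral_sub ((h2 i).integrable (by norm_num)) (hB.bddMeas i).integrable, h0,
        hB.integral_eq_zero, sub_zero]) n).trans ?_
  refine mul_le_mul_of_nonneg_left ?_ (by norm_num)
  rw [Finset.mul_sum]
  refine Finset.sum_le_sum fun i _ => ?_
  have it : MemLp (fun ω => trunc ε (W i ω)) 2 P :=
    MemLp.of_bound ((measurable_trunc ε).comp (hm i)).aestronglyMeasurable ε
        (ae_of_all _ fun ω => abs_trunc_le hε.le (W i ω))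
  have hU : MemLp (fun ω => W i ω - trunc ε (W i ω)) 2 P := (h2 i).sub it
  -- As W_i has mean zero, the remainder is W_i - trunc(W_i) centered, and centering does not
  -- increase the second moment.
  have hvar := variance_le_expectation_sq (X := fun ω => W i ω - trunc ε (W i ω)) (μ := P)
    hU.aestronglyMeasurable
  rw [variance_eq_integral hU.aestronglyMeasurable.aemeasurable,
    integral_sub ((h2 i).integrable (by norm_num)) (it.integrable (by norm_num)), h0] at hvar
  calc _ = ∫ ω, (W i ω - trunc ε (W i ω) - (0 - ∫ ω', trunc ε (W i ω') ∂P)) ^ 2 ∂P := by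
        congr 1 with ω
        ring
    _ ≤ ∫ ω, (W i ω - trunc ε (W i ω)) ^ 2 ∂P := hvar
    _ ≤ ∫ ω, ε ^ (2 - r) * |W i ω| ^ r ∂P :=
        integral_mono hU.integrable_sq ((hWr i).const_mul _) fun ω => sub_trunc_sq_le hε hr _
    _ = _ := integral_const_mul _ _

lemma abs_exp_neg_sub_exp_neg_le {x y : ℝ} (hx : 0 ≤ x) (hy : 0 ≤ y) :
    |Real.exp (-x) - Real.exp (-y)| ≤ |x - y| := by
  wlog hxy : x ≤ y generalizing x y
  · rw [abs_sub_comm, abs_sub_comm x]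
    exact this hy hx (le_of_not_ge hxy)
  have h1 : Real.exp (-y) ≤ Real.exp (-x) := Real.exp_le_exp.2 (by linarith)
  rw [abs_of_nonneg (by linarith), abs_of_nonpos (by linarith)]
  have h2 := Real.add_one_le_exp (x - y)
  have h3 : Real.exp (-y) = Real.exp (-x) * Real.exp (x - y) := by
    rw [← Real.exp_add]; ring_nf
  have h4 : Real.exp (-x) ≤ 1 := Real.exp_le_one_iff.2 (by linarith)
  rw [h3]
  nlinarith [Real.exp_pos (-x)]

/-- A quantitative central limit theorem for one-dependent variables, in terms of the Lyapunov
ratio. -/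
lemma OneDep.norm_chf_sum_sub_exp_le {W : ℕ → Ω → ℝ} (h : OneDep W P)
    (hm : ∀ i, Measurable (W i)) {r : ℝ} (hr : 2 < r) (h2 : ∀ i, MemLp (W i) 2 P)
    (hWr : ∀ i, Integrable (fun ω => |W i ω| ^ r) P)
    (h0 : ∀ i, ∫ ω, W i ω ∂P = 0) {n : ℕ} (hn : ∀ ω, W n ω = 0)
    (hvar : ∫ ω, (∑ i ∈ Finset.Ico 0 n, W i ω) ^ 2 ∂P = 1) {ε η s : ℝ} (hε : 0 < ε) (hη : 0 < η)
    (hεη : (2 * ε) ^ 2 ≤ η) (hs : 0 < s)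
    (hsr : 3 * (ε ^ (2 - r) * ∑ i ∈ Finset.Ico 0 n, ∫ ω, |W i ω| ^ r ∂P) ≤ s ^ 2) (t : ℝ) :
    ‖chf P (fun ω => ∑ i ∈ Finset.Ico 0 n, W i ω) t - (Real.exp (-(t ^ 2 / 2)) : ℝ)‖ ≤
      |t| * s + ((1 + (s ^ 2 + 2 * s)) / η + 1) * blockError t (2 * ε) η +
        t ^ 2 / 2 * (s ^ 2 + 2 * s) := by
  have hB := h.bddOneDep_trunc hm hε.le
  have hΔ := (h.integral_sub_trunc_sq_le hm hr h2 hWr h0 hε n).trans hsr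
  set Y : ℕ → Ω → ℝ := fun i ω => trunc ε (W i ω) - ∫ ω', trunc ε (W i ω') ∂P with hY
  have hYn : ∀ ω, Y n ω = 0 := fun ω => by simp [hY, hn, trunc, Set.indicator]
  have hclt := hB.norm_chf_sum_sub_exp_le hη hεη t n
  rw [hB.sum_integral_martDiff_sq hYn] at hclt
  have hSm : Measurable (fun ω => ∑ i ∈ Finset.Ico 0 n, W i ω) :=
    Finset.measurable_sum _ fun i _ => hm i
  have hTm : Measurable (fun ω => ∑ i ∈ Finset.Ico 0 n, Y i ω) :=
    Finset.measurable_sum _ fun i _ => hB.measurable i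
  have hS2 : MemLp (fun ω => ∑ i ∈ Finset.Ico 0 n, W i ω) 2 P := memLp_finsetSum _ fun i _ => h2 i
  have hT2 : MemLp (fun ω => ∑ i ∈ Finset.Ico 0 n, Y i ω) 2 P :=
    memLp_finsetSum _ fun i _ => MemLp.of_bound (hB.measurable i).aestronglyMeasurable (2 * ε)
      (ae_of_all _ (hB.abs_le i))
  change ∫ ω, (∑ i ∈ Finset.Ico 0 n, W i ω - ∑ i ∈ Finset.Ico 0 n, Y i ω) ^ 2 ∂P ≤ s ^ 2 at hΔ
  set S : Ω → ℝ := fun ω => ∑ i ∈ Finset.Ico 0 n, W i ω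
  set T : Ω → ℝ := fun ω => ∑ i ∈ Finset.Ico 0 n, Y i ω
  change ∫ ω, S ω ^ 2 ∂P = 1 at hvar
  change ∫ ω, (S ω - T ω) ^ 2 ∂P ≤ s ^ 2 at hΔ
  set V := ∫ ω, T ω ^ 2 ∂P with hV
  have hV0 : 0 ≤ V := integral_nonneg fun ω => sq_nonneg _
  have hD2 : MemLp (fun ω => S ω - T ω) 2 P := hS2.sub hT2
  have hDi := hD2.integrable_sq
  have hSi := hS2.integrable_sq
  have hTi := hT2.integrable_sq
  have habs : ∫ ω, |S ω - T ω| ∂P ≤ s := by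
    calc ∫ ω, |S ω - T ω| ∂P ≤ ∫ ω, ((2 * s)⁻¹ * (S ω - T ω) ^ 2 + s / 2) ∂P := by
          refine integral_mono (hD2.integrable (by norm_num)).abs
            ((hDi.const_mul _).add (integrable_const _)) fun ω => ?_
          dsimp only
          rw [← sq_abs (S ω - T ω), ← sub_nonneg]
          have e : (2 * s)⁻¹ * |S ω - T ω| ^ 2 + s / 2 - |S ω - T ω| =
            (2 * s)⁻¹ * (|S ω - T ω| - s) ^ 2 := by field_simp; ring
          rw [e]
          positivity
      _ = (2 * s)⁻¹ * ∫ ω, (S ω - T ω) ^ 2 ∂P + s / 2 := by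
          rw [integral_add (hDi.const_mul _) (integrable_const _), integral_const_mul]
          simp
      _ ≤ (2 * s)⁻¹ * s ^ 2 + s / 2 :=
          add_le_add_left (mul_le_mul_of_nonneg_left hΔ (by positivity)) _
      _ = s := by field_simp; ring
  -- Here and in the lower bound, Young's inequality with weight s is used; it is balanced, as S - T
  -- has L² norm at most s and S has norm 1.
  have hVle : V ≤ 1 + (s ^ 2 + 2 * s) := by
    calc V ≤ ∫ ω, ((1 + s) * S ω ^ 2 + (1 + s⁻¹) * (S ω - T ω) ^ 2) ∂P := by
          refine integral_mono hTi ((hSi.const_mul _).add (hDi.const_mul _)) fun ω => ?_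
          dsimp only
          rw [← sub_nonneg]
          have e : (1 + s) * S ω ^ 2 + (1 + s⁻¹) * (S ω - T ω) ^ 2 - T ω ^ 2 =
            s⁻¹ * (s * S ω + (S ω - T ω)) ^ 2 := by field_simp; ring
          rw [e]
          positivity
      _ = (1 + s) + (1 + s⁻¹) * ∫ ω, (S ω - T ω) ^ 2 ∂P := by
          rw [integral_add (hSi.const_mul _) (hDi.const_mul _), integral_const_mul,
            integral_const_mul, hvar, mul_one]
      _ ≤ (1 + s) + (1 + s⁻¹) * s ^ 2 :=
          add_le_add_right (mul_le_mul_of_nonneg_left hΔ (by positivity)) _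
      _ = _ := by field_simp; ring
  have hVge : 1 - (s ^ 2 + 2 * s) ≤ V := by
    have : (1 - s) * 1 ≤ V + (s⁻¹ - 1) * ∫ ω, (S ω - T ω) ^ 2 ∂P := by
      calc (1 - s) * 1 = ∫ ω, (1 - s) * S ω ^ 2 ∂P := by rw [integral_const_mul, hvar]
        _ ≤ ∫ ω, (T ω ^ 2 + (s⁻¹ - 1) * (S ω - T ω) ^ 2) ∂P := by
            refine integral_mono (hSi.const_mul _) (hTi.add (hDi.const_mul _)) fun ω => ?_
            dsimp only
            rw [← sub_nonneg]
            have e : T ω ^ 2 + (s⁻¹ - 1) * (S ω - T ω) ^ 2 - (1 - s) * S ω ^ 2 =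
              s⁻¹ * (s * S ω - (S ω - T ω)) ^ 2 := by field_simp; ring
            rw [e]
            positivity
        _ = _ := by rw [integral_add hTi (hDi.const_mul _), integral_const_mul]
    have hD0 : 0 ≤ ∫ ω, (S ω - T ω) ^ 2 ∂P := integral_nonneg fun ω => sq_nonneg _
    have h3 : s⁻¹ * ∫ ω, (S ω - T ω) ^ 2 ∂P ≤ s⁻¹ * s ^ 2 :=
      mul_le_mul_of_nonneg_left hΔ (by positivity)
    have h4 : s⁻¹ * s ^ 2 = s := by field_simp
    have := sq_nonneg s
    linarith
  have e1 : ‖chf P S t - chf P T t‖ ≤ |t| * s :=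
    (norm_chf_sub_le hSm hTm (hD2.integrable (by norm_num))).trans
      (mul_le_mul_of_nonneg_left habs (abs_nonneg t))
  have hδ : 0 ≤ blockError t (2 * ε) η := by rw [blockError]; positivity
  have e2 : ‖chf P T t - (Real.exp (-(t ^ 2 * V / 2)) : ℝ)‖ ≤
      ((1 + (s ^ 2 + 2 * s)) / η + 1) * blockError t (2 * ε) η := by
    refine hclt.trans (mul_le_mul_of_nonneg_right ?_ hδ)
    gcongr
  have e3 : ‖((Real.exp (-(t ^ 2 * V / 2)) : ℝ) : ℂ) - (Real.exp (-(t ^ 2 / 2)) : ℝ)‖ ≤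
      t ^ 2 / 2 * (s ^ 2 + 2 * s) := by
    rw [← Complex.ofReal_sub, Complex.norm_real]
    refine (abs_exp_neg_sub_exp_neg_le (by positivity) (by positivity)).trans ?_
    rw [show t ^ 2 * V / 2 - t ^ 2 / 2 = t ^ 2 / 2 * (V - 1) by ring, abs_mul,
      abs_of_nonneg (show 0 ≤ t ^ 2 / 2 by positivity)]
    exact mul_le_mul_of_nonneg_left (abs_le.2 ⟨by linarith, by linarith⟩) (by positivity)
  exact (norm_sub_le_norm_sub_add_norm_sub _ _ _).trans (add_le_add
    ((norm_sub_le_norm_sub_add_norm_sub _ _ _).trans (add_le_add e1 e2)) e3)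

end

/-! ### Choice of the parameters -/

lemma eventually_nhdsGT_zero_lt {F : ℝ → ℝ} (hF : Continuous F) {δ : ℝ} (h0 : F 0 < δ) :
    ∀ᶠ x in 𝓝[>] (0 : ℝ), F x < δ :=
  nhdsWithin_le_nhds (hF.continuousAt.eventually_lt continuousAt_const h0)

lemma exists_error_lt (t : ℝ) {δ : ℝ} (hδ : 0 < δ) :
    ∃ ε η s : ℝ, 0 < ε ∧ 0 < η ∧ 0 < s ∧ (2 * ε) ^ 2 ≤ η ∧
      |t| * s + ((1 + (s ^ 2 + 2 * s)) / η + 1) * blockError t (2 * ε) η +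
        t ^ 2 / 2 * (s ^ 2 + 2 * s) < δ := by
  -- First η, with ε = s = 0, where the error is of order √η; then ε depending on η; then s. Each
  -- choice uses continuity at 0.
  obtain ⟨η, hη, hη0⟩ := ((eventually_nhdsGT_zero_lt
    (F := fun η => (1 + η) * (|t| ^ 3 * (10 ^ 6 * √η) + 25 * t ^ 4 * η)) (by fun_prop)
    (by simpa using hδ)).and self_mem_nhdsWithin).exists
  have hη0 : 0 < η := hη0
  have e : (1 / η + 1) * blockError t (2 * 0) η =
      (1 + η) * (|t| ^ 3 * (10 ^ 6 * √η) + 25 * t ^ 4 * η) := by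
    rw [blockError]; field_simp; ring
  obtain ⟨ε, ⟨hε, hεη⟩, hε0⟩ := (((eventually_nhdsGT_zero_lt
    (F := fun ε => (1 / η + 1) * blockError t (2 * ε) η) (by unfold blockError; fun_prop)
    (e.trans_lt hη)).and (eventually_nhdsGT_zero_lt
    (F := fun ε => (2 * ε) ^ 2) (δ := η) (by fun_prop) (by simpa using hη0))).and
    self_mem_nhdsWithin).exists
  obtain ⟨s, hs, hs0⟩ := ((eventually_nhdsGT_zero_lt
    (F := fun s => |t| * s + ((1 + (s ^ 2 + 2 * s)) / η + 1) * blockError t (2 * ε) η +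
        t ^ 2 / 2 * (s ^ 2 + 2 * s)) (by fun_prop) (by simpa using hε)).and
    self_mem_nhdsWithin).exists
  exact ⟨ε, η, s, hε0, hη0, hs0, hεη.le, hs⟩

/-! ### Reduction from m-dependence to one-dependence by blocks -/

/-- The extension of a finite sequence of variables by zero. -/
def zeroExt {Ω : Type*} {N : ℕ} (X : Fin N → Ω → ℝ) (i : ℕ) (ω : Ω) : ℝ :=
  if h : i < N then X ⟨i, h⟩ ω else 0

/-- The normalized sums over consecutive blocks of length `m`. -/
noncomputable def blockSum {Ω : Type*} {N : ℕ} (X : Fin N → Ω → ℝ) (m : ℕ) (σ : ℝ) (j : ℕ)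
    (ω : Ω) : ℝ :=
  (∑ i ∈ Finset.Ico (j * m) ((j + 1) * m), zeroExt X i ω) / σ

lemma sum_sum_Ico_mul {M : Type*} [AddCommMonoid M] (f : ℕ → M) (m n : ℕ) :
    ∑ j ∈ Finset.Ico 0 n, ∑ i ∈ Finset.Ico (j * m) ((j + 1) * m), f i =
      ∑ i ∈ Finset.Ico 0 (n * m), f i := by
  induction n with
  | zero => simp
  | succ n ih =>
    rw [Finset.sum_Ico_succ_top (Nat.zero_le n), ih, Finset.sum_Ico_consecutive _ (Nat.zero_le _)
      (Nat.mul_le_mul_right m (Nat.le_succ n))]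

lemma sum_Ico_eq_sum_fin {M : Type*} [AddCommMonoid M] {N n : ℕ} (hn : N ≤ n) {f : ℕ → M}
    {g : Fin N → M} (hfg : ∀ i : Fin N, f i = g i) (hf : ∀ i, N ≤ i → f i = 0) :
    ∑ i ∈ Finset.Ico 0 n, f i = ∑ i, g i := by
  rw [← Finset.sum_Ico_consecutive _ (Nat.zero_le N) hn,
    Finset.sum_eq_zero (s := Finset.Ico N n) fun i hi => hf i (Finset.mem_Ico.1 hi).1, add_zero,
    ← Finset.range_eq_Ico, ← Fin.sum_univ_eq_sum_range]
  exact Finset.sum_congr rfl fun i _ => hfg i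

section

variable {Ω : Type*} {N : ℕ} {X : Fin N → Ω → ℝ}

lemma zeroExt_fin (i : Fin N) : zeroExt X i = X i := by
  funext ω
  simp [zeroExt]

lemma zeroExt_of_le {i : ℕ} (h : N ≤ i) : zeroExt X i = 0 := by
  funext ω
  simp [zeroExt, Nat.not_lt.2 h]

lemma zeroExt_induction {p : (Ω → ℝ) → Prop} (h0 : p 0) (hX : ∀ i, p (X i)) (i : ℕ) :
    p (zeroExt X i) := by
  rcases lt_or_ge i N with h | h
  · have : zeroExt X i = X ⟨i, h⟩ := zeroExt_fin ⟨i, h⟩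
    rw [this]
    exact hX _
  · rw [zeroExt_of_le h]
    exact h0

lemma measurable_blockSum {m' : MeasurableSpace Ω} {m j : ℕ} {σ : ℝ}
    (h : ∀ i ∈ Finset.Ico (j * m) ((j + 1) * m), Measurable[m'] (zeroExt X i)) :
    Measurable[m'] (blockSum X m σ j) :=
  (Finset.measurable_sum _ h).div_const σ

lemma sum_blockSum {m : ℕ} (hm : 1 ≤ m) (σ : ℝ) (ω : Ω) :
    ∑ j ∈ Finset.Ico 0 N, blockSum X m σ j ω = (∑ i, X i ω) / σ := by
  simp_rw [blockSum]
  rw [← Finset.sum_div, sum_sum_Ico_mul, sum_Ico_eq_sum_fin (Nat.le_mul_of_pos_right N hm)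
    (fun i => congrFun (zeroExt_fin i) ω) fun i hi => by rw [zeroExt_of_le hi]; rfl]

/-- Using N blocks instead of ⌈N/m⌉ costs nothing, since the surplus blocks are zero, and provides
the vanishing term after the last one that `BddOneDep.sum_integral_martDiff_sq` requires. -/
lemma blockSum_last {m : ℕ} (hm : 1 ≤ m) (σ : ℝ) (ω : Ω) : blockSum X m σ N ω = 0 := by
  rw [blockSum, Finset.sum_eq_zero, zero_div]
  intro i hi
  rw [zeroExt_of_le ((Nat.le_mul_of_pos_right N hm).trans (Finset.mem_Ico.1 hi).1)]
  rfl

/-- Blocks before k use indices below km, and blocks after k use indices from km + m on: the omitted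
block k is exactly the gap of length m. -/
lemma MDependent.oneDep_blockSum [mΩ : MeasurableSpace Ω] {P : Measure Ω} {m : ℕ}
    (h : MDependent m X P) (σ : ℝ) : OneDep (blockSum X m σ) P := by
  intro k
  refine indep_of_indep_of_le (h (k * m)) (pastAlg_le fun j hj => ?_)
    (futureAlg_le fun j hj => ?_)
  · refine measurable_blockSum fun i hi => ?_
    rcases lt_or_ge i N with hiN | hiN
    · have hik : i < k * m :=
        (Finset.mem_Ico.1 hi).2.trans_le (Nat.mul_le_mul_right m (Nat.succ_le_of_lt hj))
      have e : zeroExt X i = (fun x : {i : Fin N // i.val < k * m} → ℝ => x ⟨⟨i, hiN⟩, hik⟩) ∘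
          (fun ω (i : {i : Fin N // i.val < k * m}) => X i.1 ω) := zeroExt_fin ⟨i, hiN⟩
      rw [e]
      exact (measurable_pi_apply _).comp (comap_measurable _)
    · rw [zeroExt_of_le hiN]
      exact measurable_const
  · refine measurable_blockSum fun i hi => ?_
    rcases lt_or_ge i N with hiN | hiN
    · have hik : k * m + m ≤ i := by
        have h1 := Nat.mul_le_mul_right m hj
        have h2 := (Finset.mem_Ico.1 hi).1
        rw [Nat.succ_mul] at h1
        omega
      have e : zeroExt X i = (fun x : {j : Fin N // k * m + m ≤ j.val} → ℝ =>
          x ⟨⟨i, hiN⟩, hik⟩) ∘ (fun ω (j : {j : Fin N // k * m + m ≤ j.val}) => X j.1 ω) :=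
        zeroExt_fin ⟨i, hiN⟩
      rw [e]
      exact (measurable_pi_apply _).comp (comap_measurable _)
    · rw [zeroExt_of_le hiN]
      exact measurable_const

/-- The power mean inequality for m terms; this is where the factor m^(r-1) of the Lyapunov
condition comes from. -/
lemma abs_blockSum_rpow_le {m : ℕ} {σ r : ℝ} (hσ : 0 < σ) (hr : 1 ≤ r) (j : ℕ) (ω : Ω) :
    |blockSum X m σ j ω| ^ r ≤ (m : ℝ) ^ (r - 1) / σ ^ r *
      ∑ i ∈ Finset.Ico (j * m) ((j + 1) * m), |zeroExt X i ω| ^ r := by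
  have hc : (Finset.Ico (j * m) ((j + 1) * m)).card = m := by
    rw [Nat.card_Ico, Nat.succ_mul]; omega
  have h1 := Real.rpow_sum_le_const_mul_sum_rpow (Finset.Ico (j * m) ((j + 1) * m))
    (fun i => zeroExt X i ω) hr
  rw [hc] at h1
  have h2 : |∑ i ∈ Finset.Ico (j * m) ((j + 1) * m), zeroExt X i ω| ^ r ≤ _ :=
    (Real.rpow_le_rpow (abs_nonneg _) (Finset.abs_sum_le_sum_abs _ _) (by linarith)).trans h1
  rw [blockSum, abs_div, abs_of_pos hσ, Real.div_rpow (abs_nonneg _) hσ.le, div_mul_eq_mul_div]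
  exact div_le_div_of_nonneg_right h2 (by positivity)

end

section

variable {Ω : Type*} [mΩ : MeasurableSpace Ω] {P : Measure Ω} {N : ℕ} {X : Fin N → Ω → ℝ} {m : ℕ}
  {r : ℝ}

lemma memLp_of_integrable_abs_rpow {f : Ω → ℝ} (hf : Measurable f) (hr : 2 < r)
    (hi : Integrable (fun ω => |f ω| ^ r) P) : MemLp f (ENNReal.ofReal r) P := by
  rw [← integrable_norm_rpow_iff hf.aestronglyMeasurable
    (by simpa using by linarith) ENNReal.ofReal_ne_top, ENNReal.toReal_ofReal (by linarith)]
  exact hi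

variable [IsProbabilityMeasure P]

lemma memLp_two_of_integrable_abs_rpow {f : Ω → ℝ} (hf : Measurable f) (hr : 2 < r)
    (hi : Integrable (fun ω => |f ω| ^ r) P) : MemLp f 2 P := by
  refine (memLp_of_integrable_abs_rpow hf hr hi).mono_exponent ?_
  rw [← ENNReal.ofReal_ofNat]
  exact ENNReal.ofReal_le_ofReal hr.le

/-- A quantitative central limit theorem for a row of `m`-dependent variables. -/
lemma MDependent.norm_chf_sum_sub_exp_le (h : MDependent m X P) (hm : 1 ≤ m)
    (hX : ∀ i, Measurable (X i)) (h0 : ∀ i, ∫ ω, X i ω ∂P = 0) (hr : 2 < r)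
    (hXr : ∀ i, Integrable (fun ω => |X i ω| ^ r) P) (hv : 0 < Var[fun ω => ∑ i, X i ω; P])
    {ε η s : ℝ} (hε : 0 < ε) (hη : 0 < η) (hεη : (2 * ε) ^ 2 ≤ η) (hs : 0 < s)
    (hsr : 3 * (ε ^ (2 - r) * ((m : ℝ) ^ (r - 1) / √Var[fun ω => ∑ i, X i ω; P] ^ r *
      ∑ i, ∫ ω, |X i ω| ^ r ∂P)) ≤ s ^ 2) (t : ℝ) :
    ‖chf P (fun ω => (∑ i, X i ω) / √Var[fun ω => ∑ i, X i ω; P]) t -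
      (Real.exp (-(t ^ 2 / 2)) : ℝ)‖ ≤
      |t| * s + ((1 + (s ^ 2 + 2 * s)) / η + 1) * blockError t (2 * ε) η +
        t ^ 2 / 2 * (s ^ 2 + 2 * s) := by
  set σ := √Var[fun ω => ∑ i, X i ω; P] with hσ
  have hσ0 : 0 < σ := Real.sqrt_pos.2 hv
  have hr0 : r ≠ 0 := by linarith
  have hXe : ∀ i, Measurable (zeroExt X i) := zeroExt_induction measurable_const hX
  have hXer : ∀ i, Integrable (fun ω => |zeroExt X i ω| ^ r) P :=
    zeroExt_induction (p := fun f => Integrable (fun ω => |f ω| ^ r) P)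
      (by simp [Real.zero_rpow hr0]) hXr
  have hXe0 : ∀ i, ∫ ω, zeroExt X i ω ∂P = 0 :=
    zeroExt_induction (p := fun f => ∫ ω, f ω ∂P = 0) (by simp) h0
  have hW : ∀ j, Measurable (blockSum X m σ j) := fun j => measurable_blockSum fun i _ => hXe i
  have hdom : ∀ j, Integrable (fun ω => (m : ℝ) ^ (r - 1) / σ ^ r *
      ∑ i ∈ Finset.Ico (j * m) ((j + 1) * m), |zeroExt X i ω| ^ r) P := fun j =>
    (integrable_finsetSum _ fun i _ => hXer i).const_mul _
  have hle := fun (j : ℕ) (ω : Ω) =>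
    abs_blockSum_rpow_le (X := X) (m := m) hσ0 (show 1 ≤ r by linarith) j ω
  have hWr : ∀ j, Integrable (fun ω => |blockSum X m σ j ω| ^ r) P := fun j =>
    (hdom j).mono' ((hW j).abs.pow_const r).aestronglyMeasurable (ae_of_all _ fun ω => by
      rw [Real.norm_of_nonneg (by positivity)]
      exact hle j ω)
  have hW2 : ∀ j, MemLp (blockSum X m σ j) 2 P := fun j =>
    memLp_two_of_integrable_abs_rpow (hW j) hr (hWr j)
  have hXi : ∀ i, Integrable (zeroExt X i) P := fun i =>
    (memLp_two_of_integrable_abs_rpow (hXe i) hr (hXer i)).integrable (by norm_num)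
  have hW0 : ∀ j, ∫ ω, blockSum X m σ j ω ∂P = 0 := fun j => by
    simp_rw [blockSum]
    rw [integral_div, integral_finsetSum _ fun i _ => hXi i, Finset.sum_eq_zero fun i _ => hXe0 i,
      zero_div]
  have hvar : ∫ ω, (∑ j ∈ Finset.Ico 0 N, blockSum X m σ j ω) ^ 2 ∂P = 1 := by
    simp_rw [sum_blockSum hm, div_pow]
    have hXm : Measurable (fun ω => ∑ i, X i ω) := Finset.measurable_sum _ fun i _ => hX i
    rw [integral_div, ← variance_of_integral_eq_zero hXm.aemeasurable, hσ, Real.sq_sqrt hv.le,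
      div_self hv.ne']
    rw [integral_finsetSum _ fun i _ => (memLp_two_of_integrable_abs_rpow (hX i) hr
      (hXr i)).integrable (by norm_num), Finset.sum_eq_zero fun i _ => h0 i]
  have hsum : ∑ j ∈ Finset.Ico 0 N, ∫ ω, |blockSum X m σ j ω| ^ r ∂P ≤
      (m : ℝ) ^ (r - 1) / σ ^ r * ∑ i, ∫ ω, |X i ω| ^ r ∂P := by
    rw [← sum_Ico_eq_sum_fin (Nat.le_mul_of_pos_right N hm)
      (f := fun i => ∫ ω, |zeroExt X i ω| ^ r ∂P) (fun i => by rw [zeroExt_fin])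
      (fun i hi => by simp [zeroExt_of_le hi, Real.zero_rpow hr0]), ← sum_sum_Ico_mul,
      Finset.mul_sum]
    refine Finset.sum_le_sum fun j _ => (integral_mono (hWr j) (hdom j) (hle j)).trans_eq ?_
    rw [integral_const_mul, integral_finsetSum _ fun i _ => hXer i]
  have key := (h.oneDep_blockSum σ).norm_chf_sum_sub_exp_le hW hr hW2 hWr hW0
    (blockSum_last hm σ) hvar hε hη hεη hs
    ((mul_le_mul_of_nonneg_left (mul_le_mul_of_nonneg_left hsum (by positivity))
      (by norm_num)).trans hsr) t
  simp_rw [sum_blockSum hm] at key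
  exact key

end

/-! ### The limit theorem, by Lévy's continuity theorem -/

lemma charFun_map_eq_chf {Ω : Type*} [MeasurableSpace Ω] {P : Measure Ω} {f : Ω → ℝ}
    (hf : AEMeasurable f P) (t : ℝ) : charFun (P.map f) t = chf P f t := by
  rw [charFun_apply_real, integral_map hf (Measurable.aestronglyMeasurable (by fun_prop)), chf]
  congr 1 with ω
  push_cast
  ring_nf

/-- The central limit theorem for triangular arrays of `m`-dependent variables under a
Lyapunov condition. -/
theorem asymptoticallyNormal_of_lyapunovCondition {Ω : ℕ → Type*} [∀ n, MeasurableSpace (Ω n)]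
    {P : ∀ n, Measure (Ω n)} [∀ n, IsProbabilityMeasure (P n)]
    {N : ℕ → ℕ} {m : ℕ → ℕ} (hm : ∀ n, 1 ≤ m n) {X : ∀ n, Fin (N n) → Ω n → ℝ}
    (hX_meas : ∀ n i, Measurable (X n i)) (hX_mean : ∀ n i, ∫ ω, X n i ω ∂(P n) = 0)
    (hX_dep : ∀ n, MDependent (m n) (X n) (P n)) (hv : ∀ᶠ n in atTop, 0 < rowVar P X n)
    {r : ℝ} (hr : 2 < r) (hL : LyapunovCondition P X m r) : AsymptoticallyNormal P X := by
  have hS : ∀ n, Measurable (fun ω => rowSum X n ω / rowStd P X n) := fun n =>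
    (Finset.measurable_sum _ fun i _ => hX_meas n i).div_const _
  refine ⟨fun n => (hS n).aemeasurable, aemeasurable_id, ?_⟩
  refine ProbabilityMeasure.tendsto_iff_tendsto_charFun.2 fun t => ?_
  have hlim : charFun ((gaussianReal 0 1).map id) t = (Real.exp (-(t ^ 2 / 2)) : ℝ) := by
    rw [Measure.map_id, charFun_gaussianReal]
    push_cast
    congr 1
    simp
  simp only [ProbabilityMeasure.coe_mk, hlim]
  rw [Metric.tendsto_nhds]
  intro δ hδ
  obtain ⟨ε, η, s, hε, hη, hs, hεη, hlt⟩ := exists_error_lt t hδ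
  have hsmall : ∀ᶠ n in atTop, 3 * (ε ^ (2 - r) * ((m n : ℝ) ^ (r - 1) / rowStd P X n ^ r *
      ∑ i, ∫ ω, |X n i ω| ^ r ∂(P n))) < s ^ 2 := by
    have := (hL.2.const_mul (ε ^ (2 - r))).const_mul 3
    rw [mul_zero, mul_zero] at this
    exact this.eventually_lt_const (by positivity)
  filter_upwards [hv, hL.1, hsmall] with n hv hi hsm
  rw [charFun_map_eq_chf (hS n).aemeasurable, dist_eq_norm]
  exact ((hX_dep n).norm_chf_sum_sub_exp_le (hm n) (hX_meas n) (hX_mean n) hr hi hv hε hη hεη hs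
    hsm.le t).trans_lt hlt

/-! ### The theorems of Romano–Wolf and Berk -/

/-- Insert V ≥ L N M^γ and compare powers of M: 1 + δ - γ(1 + δ/2) = (δ/2)(1 + (1 - γ)(1 + 2/δ)).
The Lyapunov ratio is thereby a bounded factor times a power of the quantity assumed to tend to 0.
-/
lemma div_sqrt_rpow_mul_le {V N M L Δ δ γ T : ℝ} (hδ : 0 < δ) (hN : 0 < N) (hM : 0 < M)
    (hL : 0 < L) (hLV : L ≤ V / (N * M ^ γ)) (hΔ : 0 ≤ Δ) (hT : T ≤ N * Δ) :
    M ^ (2 + δ - 1) / √V ^ (2 + δ) * T ≤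
      Δ / L ^ ((2 + δ) / 2) * (M ^ (1 + (1 - γ) * (1 + 2 / δ)) / N) ^ (δ / 2) := by
  have hMγ : 0 < M ^ γ := Real.rpow_pos_of_pos hM γ
  have hLV' : L * (N * M ^ γ) ≤ V := (le_div_iff₀ (by positivity)).1 hLV
  have hV : 0 < V := lt_of_lt_of_le (by positivity) hLV'
  have e1 : √V ^ (2 + δ) = V ^ ((2 + δ) / 2) := by
    rw [Real.sqrt_eq_rpow, ← Real.rpow_mul hV.le]
    ring_nf
  have e2 : (L * (N * M ^ γ)) ^ ((2 + δ) / 2) ≤ V ^ ((2 + δ) / 2) :=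
    Real.rpow_le_rpow (by positivity) hLV' (by positivity)
  have e3 : (L * (N * M ^ γ)) ^ ((2 + δ) / 2) =
      L ^ ((2 + δ) / 2) * (N * N ^ (δ / 2) * M ^ (γ * ((2 + δ) / 2))) := by
    rw [Real.mul_rpow hL.le (by positivity), Real.mul_rpow hN.le hMγ.le, ← Real.rpow_mul hM.le,
      show (2 + δ) / 2 = 1 + δ / 2 by ring, Real.rpow_add hN, Real.rpow_one]
  have e4 : (M ^ (1 + (1 - γ) * (1 + 2 / δ)) / N) ^ (δ / 2) =
      M ^ (2 + δ - 1) / M ^ (γ * ((2 + δ) / 2)) / N ^ (δ / 2) := by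
    rw [Real.div_rpow (by positivity) hN.le, ← Real.rpow_mul hM.le, ← Real.rpow_sub hM]
    congr 2
    field_simp
    ring
  calc M ^ (2 + δ - 1) / √V ^ (2 + δ) * T
      ≤ M ^ (2 + δ - 1) / (L ^ ((2 + δ) / 2) * (N * N ^ (δ / 2) * M ^ (γ * ((2 + δ) / 2)))) *
          (N * Δ) := by
        rw [e1, ← e3]
        exact (mul_le_mul_of_nonneg_left hT (by positivity)).trans (mul_le_mul_of_nonneg_right
          (div_le_div_of_nonneg_left (by positivity) (by positivity) e2) (by positivity))
    _ = _ := by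
        rw [e4]
        field_simp

section

variable {Ω : ℕ → Type*} [∀ n, MeasurableSpace (Ω n)] {P : ∀ n, Measure (Ω n)}
  {N : ℕ → ℕ} {m : ℕ → ℕ} {X : ∀ n, Fin (N n) → Ω n → ℝ} {δ γ : ℝ}

theorem RomanoWolfCondition.eventually_rowVar_pos (hN : ∀ n, 1 ≤ N n) (hm : ∀ n, 1 ≤ m n)
    (h : RomanoWolfCondition P X m δ γ) : ∀ᶠ n in atTop, 0 < rowVar P X n := by
  obtain ⟨Δ, L, hL, -, hLV, -⟩ := h
  filter_upwards [hL] with n hn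
  have hN' : (0 : ℝ) < N n := by exact_mod_cast hN n
  have hm' : (0 : ℝ) < m n := by exact_mod_cast hm n
  have := hn.trans_le (hLV n)
  rwa [div_pos_iff_of_pos_right (mul_pos hN' (Real.rpow_pos_of_pos hm' γ))] at this

theorem RomanoWolfCondition.lyapunovCondition (hN : ∀ n, 1 ≤ N n) (hm : ∀ n, 1 ≤ m n)
    (hδ : 0 < δ) (h : RomanoWolfCondition P X m δ γ) : LyapunovCondition P X m (2 + δ) := by
  obtain ⟨Δ, L, hL, hX, hLV, hO, hlim⟩ := h
  refine ⟨Eventually.of_forall fun n i => (hX n i).1, ?_⟩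
  have hq : Tendsto (fun n => ((m n : ℝ) ^ (1 + (1 - γ) * (1 + 2 / δ)) / (N n : ℝ)) ^ (δ / 2))
      atTop (𝓝 0) := by
    have := hlim.rpow_const (p := δ / 2) (Or.inr (by positivity))
    rwa [Real.zero_rpow (by positivity)] at this
  have hbound := (hO.mul_isLittleO ((isLittleO_one_iff ℝ).2 hq))
  simp only [mul_one] at hbound
  refine squeeze_zero' (Eventually.of_forall fun n => ?_) ?_ ((isLittleO_one_iff ℝ).1 hbound)
  · have : 0 ≤ rowStd P X n := Real.sqrt_nonneg _
    have : 0 ≤ ∑ i, ∫ ω, |X n i ω| ^ (2 + δ) ∂(P n) :=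
      Finset.sum_nonneg fun i _ => integral_nonneg fun ω => by positivity
    positivity
  · filter_upwards [hL] with n hn
    have hN' : (0 : ℝ) < N n := by exact_mod_cast hN n
    have hm' : (0 : ℝ) < m n := by exact_mod_cast hm n
    have hΔ : 0 ≤ Δ n :=
      (integral_nonneg fun ω => by positivity).trans (hX n ⟨0, hN n⟩).2
    refine div_sqrt_rpow_mul_le hδ hN' hm' hn (hLV n) hΔ ?_
    calc ∑ i, ∫ ω, |X n i ω| ^ (2 + δ) ∂(P n) ≤ ∑ _i : Fin (N n), Δ n :=
          Finset.sum_le_sum fun i _ => (hX n i).2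
      _ = N n * Δ n := by simp

/-- Berk's conditions are a special case of those of Romano and Wolf. -/
theorem BerkCondition.romanoWolfCondition
    (h : BerkCondition P X m δ) : RomanoWolfCondition P X m δ 0 := by
  obtain ⟨⟨C, hC⟩, ⟨c, hc, hlim⟩, ho⟩ := h
  -- With γ = 0 the lower bound L_n can be the normalized variance itself, which is eventually
  -- positive because its limit is c > 0.
  refine ⟨fun _ => C, fun n => rowVar P X n / N n, hlim.eventually_const_lt hc, hC,
    fun n => by simp, ?_, ?_⟩
  · exact (tendsto_const_nhds.div (hlim.rpow_const (Or.inl hc.ne'))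
      (Real.rpow_pos_of_pos hc _).ne').isBigO_one ℝ
  · have := ho.tendsto_div_nhds_zero
    convert this using 4
    ring

end

theorem theorem3 {Ω : ℕ → Type*} [∀ n, MeasurableSpace (Ω n)]
    (P : ∀ n, Measure (Ω n)) [∀ n, IsProbabilityMeasure (P n)]
    (N : ℕ → ℕ) (hN : ∀ n, 1 ≤ N n) (m : ℕ → ℕ) (hm : ∀ n, 1 ≤ m n)
    (X : ∀ n, Fin (N n) → Ω n → ℝ)
    (hX_meas : ∀ n i, Measurable (X n i))
    (hX_int : ∀ n i, Integrable (X n i) (P n))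
    (hX_mean : ∀ n i, ∫ ω, X n i ω ∂(P n) = 0)
    (hX_dep : ∀ n, MDependent (m n) (X n) (P n)) :
    ((∀ᶠ n in atTop, 0 < rowVar P X n) →
      ∀ r : ℝ, 2 < r → LyapunovCondition P X m r → AsymptoticallyNormal P X) ∧
    (∀ δ : ℝ, 0 < δ → BerkCondition P X m δ →
      (∀ᶠ n in atTop, 0 < rowVar P X n) ∧ LyapunovCondition P X m (2 + δ) ∧
        AsymptoticallyNormal P X) ∧
    (∀ δ γ : ℝ, 0 < δ → -1 ≤ γ → γ < 1 → RomanoWolfCondition P X m δ γ →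
      (∀ᶠ n in atTop, 0 < rowVar P X n) ∧ LyapunovCondition P X m (2 + δ) ∧
        AsymptoticallyNormal P X) := by
  have clt : (∀ᶠ n in atTop, 0 < rowVar P X n) →
      ∀ r : ℝ, 2 < r → LyapunovCondition P X m r → AsymptoticallyNormal P X := fun hv r hr hL =>
    asymptoticallyNormal_of_lyapunovCondition hm hX_meas hX_mean hX_dep hv hr hL
  have rw_clt : ∀ δ γ : ℝ, 0 < δ → RomanoWolfCondition P X m δ γ →
      (∀ᶠ n in atTop, 0 < rowVar P X n) ∧ LyapunovCondition P X m (2 + δ) ∧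
        AsymptoticallyNormal P X := fun δ γ hδ h =>
    have hv := h.eventually_rowVar_pos hN hm
    have hL := h.lyapunovCondition hN hm hδ
    ⟨hv, hL, clt hv (2 + δ) (by linarith) hL⟩
  exact ⟨clt, fun δ hδ h => rw_clt δ 0 hδ (h.romanoWolfCondition),
    fun δ γ hδ _ _ h => rw_clt δ γ hδ h⟩
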